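/- Let $p>1$, $p'=\frac{p}{p-1}$ and $\theta\in(0,1)$. Let $D\in C^1(0,1)$ with $D>0$ on $(0,1)$ (possibly degenerate or singular at $0$ and $1$), let $h\in C[0,1]$, $H(u)=\int_0^u h(s)\,ds$, $h_m=\min_{[0,1]}h$, and let $g\in C[0,1]$ satisfy $g=0$ on $[0,\theta]$, $g>0$ on $(\theta,1)$, $g(1)=0$. Assume $\int_0^1 D^{p'-1}(u)g(u)\,du<+\infty$. For $c\in\mathbb R$ consider $$\left(D(u)|u'|^{p-2}u'\right)'+(c+h(u))u'+g(u)=0,\qquad u(-\infty)=1,\quad u(+\infty)=0. \tag{1}$$ A solution of (1) is a continuous function $u:\mathbb R\to[0,1]$ such that, with $I_u=\{\xi: 0<u(\xi)<1\}$: (a) $u\in C^1(I_u)$ and the equation holds at every point of $I_u$; (b) the function $\xi\mapsto D(u(\xi))|u'(\xi)|^{p-2}u'(\xi)$, taken to be $0$ where $u\in\{0,1\}$, is continuous on $\mathbb R$ and tends to $0$ as $u(\xi)\to0$ and as $u(\xi)\to1$; (c) $u(\xi)\to1$ as $\xi\to-\infty$ and $u(\xi)\to0$ as $\xi\to+\infty$.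 Let $$k(p)=\begin{cases}\dfrac1{2^{p'-1}-1}&\text{if }1<p<2,\\ 1&\text{if }p=2,\\ \dfrac{p'}{p'-1+\dfrac{1+p'(p'-1)^{\frac1{p'-2}}+(p'-1)^{\frac{p'}{p'-2}}}{\left(1+(p'-1)^{\frac1{p'-2}}\right)^{p'}}}&\text{if }p>2.\end{cases}$$ Theorem. Suppose $h(u)>0$ for all $u\in[0,1]$ and $$H(1)\le\left(k(p)\int_0^1 D^{p'-1}(u)g(u)\,du\right)^{1/p'}.$$ Then there is a unique $c=c^*\in\mathbb R$ for which (1) has a solution; for $c=c^*$ the solution is unique up to translation; and $c^*>0>-h_m$. -/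

import Mathlib

open Set Filter Topology

noncomputable section

namespace TravelingWave

/-- The conjugate exponent `p' = p / (p - 1)`. -/
def conj (p : ℝ) : ℝ := p / (p - 1)

/-- The convective flux `H(u) = ∫₀ᵘ h(s) ds` with convective velocity `h`. -/
def convFlux (h : ℝ → ℝ) (u : ℝ) : ℝ := ∫ s in (0 : ℝ)..u, h s

/-- The minimum `h_m` of `h` over `[0,1]`; it is attained whenever `h` is continuous on `[0,1]`. -/
def hMin (h : ℝ → ℝ) : ℝ := sInf (h '' Icc (0 : ℝ) 1)

/-- The constant `k(p)`, `p > 1`. -/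
def kConst (p : ℝ) : ℝ :=
  if p < 2 then 1 / ((2 : ℝ) ^ (conj p - 1) - 1)
  else if p = 2 then 1
  else
    conj p /
      (conj p - 1 +
        (1 + conj p * (conj p - 1) ^ (1 / (conj p - 2))
            + (conj p - 1) ^ (conj p / (conj p - 2))) /
          (1 + (conj p - 1) ^ (1 / (conj p - 2))) ^ conj p)

/-- The set `I_u` on which the profile lies strictly between the two equilibria. -/
def interiorSet (u : ℝ → ℝ) : Set ℝ := {ξ | 0 < u ξ ∧ u ξ < 1}

/-- The diffusive flux `ξ ↦ D(u(ξ)) |u'(ξ)|^(p-2) u'(ξ)`. The coefficient `D` is only given on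
`(0,1)`; where `u` equals `0` or `1` the flux has the value `0`
(there `u'(ξ)`, if it exists, vanishes, since `u` has values in `[0,1]`). -/
def diffFlux (p : ℝ) (D u : ℝ → ℝ) : ℝ → ℝ :=
  (interiorSet u).indicator fun ξ => D (u ξ) * |deriv u ξ| ^ (p - 2) * deriv u ξ

/-- `u` is a (possibly non-smooth) solution of
`(D(u) |u'|^(p-2) u')' + (c + h(u)) u' + g(u) = 0`, `u(-∞) = 1`, `u(+∞) = 0`. -/
structure IsProfile (p : ℝ) (D h g : ℝ → ℝ) (c : ℝ) (u : ℝ → ℝ) : Prop where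
  mem_Icc : ∀ ξ, u ξ ∈ Icc (0 : ℝ) 1
  continuous : Continuous u
  contDiffOn : ContDiffOn ℝ 1 u (interiorSet u)
  equation : ∀ ξ ∈ interiorSet u,
    DifferentiableAt ℝ (diffFlux p D u) ξ ∧
      deriv (diffFlux p D u) ξ + (c + h (u ξ)) * deriv u ξ + g (u ξ) = 0
  flux_continuous : Continuous (diffFlux p D u)
  /-- the flux tends to `0` as `u(ξ) → 0` -/
  flux_zero : Tendsto (diffFlux p D u) (comap u (𝓝 0)) (𝓝 0)
  /-- the flux tends to `0` as `u(ξ) → 1` -/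
  flux_one : Tendsto (diffFlux p D u) (comap u (𝓝 1)) (𝓝 0)
  tendsto_atBot : Tendsto u atBot (𝓝 1)
  tendsto_atTop : Tendsto u atTop (𝓝 0)

/-- `c` is the unique wave speed: there is a profile for the speed `c`, it is unique up to
translation, and no other real speed admits a profile. -/
structure IsUniqueWaveSpeed (p : ℝ) (D h g : ℝ → ℝ) (c : ℝ) : Prop where
  exists_profile : ∃ u, IsProfile p D h g c u
  profile_unique : ∀ u v, IsProfile p D h g c u → IsProfile p D h g c v →
    ∃ τ : ℝ, ∀ ξ, v ξ = u (ξ + τ)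
  speed_unique : ∀ c' u, IsProfile p D h g c' u → c' = c

end TravelingWave

end

/-!
Regarded as a function `V` of the concentration `u`, the flux of a decreasing front, with its sign
changed, satisfies `V' = c + h - r V ^ (1 - p')` with `r = D ^ (p' - 1) g` and `V(0) = V(1) = 0`.
Below the threshold `θ` the reaction vanishes, so there `V(u) = c u + H(u)`. Beyond `θ` the power
`y = V ^ p'` satisfies an equation that is regular at `y = 0`, and is solved backward from
`y(1) = 0`; the speed `c` is then found by matching the two pieces at `θ`. At `c = 0` the backward
solution is larger than `H` at `θ`: otherwise `V ≤ H` on `[θ, 1]`, so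
`y - H ^ p' + p' ∫ r` would decrease from a nonpositive value to
`p' ∫ r - H(1) ^ p' > 0`. For large `c` it is smaller, since `y ≤ p' ∫ r`. The front is recovered
from `V` by integrating `u' = -(V / D) ^ (p' - 1)` and inverting.

Conversely, for any front `u` the sum of the diffusive and the convective flux is nonincreasing
in `ξ`, which forces `u` to decrease strictly while it lies in `(θ, 1)`. The gap between `V(u)` and
minus the diffusive flux of `u` then has a sign up to the time when `u` reaches `θ`, and the
matching condition there gives equality of the speeds and of the fluxes, hence of the fronts up to
translation. A front may rest at `0` or `1`, where the equation is not available; as these are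
only two values, monotonicity is not affected.
-/

namespace TravelingWave

/-! ### One-variable comparison principles -/

theorem le_of_deriv_nonpos_above {w : ℝ → ℝ} {a b m : ℝ} (hab : a ≤ b)
    (hw : ContinuousOn w (Icc a b)) (ha : w a ≤ m)
    (hd : ∀ x ∈ Ioo a b, m < w x → ∃ w', HasDerivAt w w' x ∧ w' ≤ 0) : w b ≤ m := by
  obtain ⟨s, ⟨hs, hsm⟩, hlast⟩ : ∃ s, IsGreatest (Icc a b ∩ w ⁻¹' Iic m) s :=
    (isCompact_Icc.of_isClosed_subset (hw.preimage_isClosed_of_isClosed isClosed_Icc isClosed_Iic)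
      inter_subset_left).exists_isGreatest ⟨a, left_mem_Icc.2 hab, ha⟩
  have hd' : ∀ x ∈ interior (Icc s b), ∃ w', HasDerivAt w w' x ∧ w' ≤ 0 := by
    rw [interior_Icc]
    refine fun x hx => hd x ⟨hs.1.trans_lt hx.1, hx.2⟩ ?_
    by_contra! hle
    exact hx.1.not_ge (hlast ⟨⟨(hs.1.trans_lt hx.1).le, hx.2.le⟩, hle⟩)
  have hanti : AntitoneOn w (Icc s b) := by
    refine antitoneOn_of_deriv_nonpos (convex_Icc s b) (hw.mono (Icc_subset_Icc_left hs.1))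
      (fun x hx => ?_) fun x hx => ?_
    · obtain ⟨w', hw', -⟩ := hd' x hx
      exact hw'.differentiableAt.differentiableWithinAt
    · obtain ⟨w', hw', hle⟩ := hd' x hx
      exact hw'.deriv.trans_le hle
  exact (hanti (left_mem_Icc.2 hs.2) (right_mem_Icc.2 hs.2) hs.2).trans hsm

theorem le_add_of_le_deriv_above {w : ℝ → ℝ} {a b m κ : ℝ} (hab : a ≤ b) (hκ : 0 ≤ κ)
    (hw : ContinuousOn w (Icc a b)) (hb : w b ≤ m)
    (hd : ∀ x ∈ Ioo a b, m < w x → ∃ w', HasDerivAt w w' x ∧ -κ ≤ w') :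
    w a ≤ m + κ * (b - a) := by
  have hline : ContinuousOn (fun x => w (-x) - κ * (x + b)) (Icc (-b) (-a)) :=
    (hw.comp continuous_neg.continuousOn fun x hx =>
      ⟨le_neg.1 hx.2, neg_le.1 hx.1⟩).sub (by fun_prop)
  have := le_of_deriv_nonpos_above (neg_le_neg hab) hline (m := m) (by simpa using hb)
    fun x hx hmx => by
      have hx0 : 0 ≤ κ * (x + b) := mul_nonneg hκ (by linarith [hx.1])
      obtain ⟨w', hw', hle⟩ := hd (-x) ⟨lt_neg.1 hx.2, neg_lt.1 hx.1⟩ (by linarith)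
      refine ⟨-w' - κ, ?_, by linarith⟩
      simpa [Function.comp_def] using
        (hw'.comp x (hasDerivAt_neg x)).fun_sub (((hasDerivAt_id' x).add_const b).const_mul κ)
  simp only [neg_neg] at this
  linarith

theorem le_of_deriv_nonpos_above_of_finite {w : ℝ → ℝ} {a b m : ℝ} {S : Set ℝ} (hS : S.Finite)
    (hab : a ≤ b) (hw : ContinuousOn w (Icc a b)) (ha : w a ≤ m)
    (hd : ∀ x ∈ Ioo a b, m < w x → w x ∉ S → ∃ w', HasDerivAt w w' x ∧ w' ≤ 0) : w b ≤ m := by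
  by_contra! hlt
  -- On the first crossing of a band of values that avoids `S`, `w` would have to increase.
  obtain ⟨y, hy, hyS⟩ := (Ioo_infinite hlt).exists_notMem_finite hS
  obtain ⟨y', hyy', hband⟩ := exists_Ico_subset_of_mem_nhds
    ((isOpen_Ioo.sdiff hS.isClosed).mem_nhds ⟨hy, hyS⟩) (exists_gt y)
  obtain ⟨z, hyz, hzy'⟩ := exists_between hyy'
  obtain ⟨β, ⟨hβ, hzβ⟩, hfirst⟩ : ∃ s, IsLeast (Icc a b ∩ w ⁻¹' Ici z) s :=
    (isCompact_Icc.of_isClosed_subset (hw.preimage_isClosed_of_isClosed isClosed_Icc isClosed_Ici)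
      inter_subset_left).exists_isLeast ⟨b, right_mem_Icc.2 hab, (hband ⟨hyz.le, hzy'⟩).1.2.le⟩
  have hβy : w β ≤ y := le_of_deriv_nonpos_above hβ.1 (hw.mono (Icc_subset_Icc_right hβ.2))
    (ha.trans hy.1.le) fun x hx hyx => by
      have hxz : w x < z := by
        by_contra! hle
        exact hx.2.not_ge (hfirst ⟨⟨hx.1.le, (hx.2.trans_le hβ.2).le⟩, hle⟩)
      exact hd x ⟨hx.1, hx.2.trans_le hβ.2⟩ (hy.1.trans hyx) (hband ⟨hyx.le, hxz.trans hzy'⟩).2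
  exact (hyz.trans_le hzβ).not_ge hβy

theorem eventually_lt_right_of_deriv_neg {f : ℝ → ℝ} {f' x : ℝ} (hf : HasDerivAt f f' x)
    (hf' : f' < 0) : ∀ᶠ y in 𝓝[>] x, f y < f x := by
  have hslope := (hasDerivAt_iff_tendsto_slope.1 hf).mono_left
    (nhdsWithin_mono x fun y (hy : x < y) => hy.ne')
  filter_upwards [hslope.eventually_lt_const hf', self_mem_nhdsWithin] with y hy hxy
  rw [slope_def_field] at hy
  exact sub_neg.1 (neg_of_div_neg_left hy (sub_pos.2 hxy).le)

theorem eventually_gt_left_of_deriv_neg {f : ℝ → ℝ} {f' x : ℝ} (hf : HasDerivAt f f' x)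
    (hf' : f' < 0) : ∀ᶠ y in 𝓝[<] x, f x < f y := by
  have hslope := (hasDerivAt_iff_tendsto_slope.1 hf).mono_left
    (nhdsWithin_mono x fun y (hy : y < x) => hy.ne)
  filter_upwards [hslope.eventually_lt_const hf', self_mem_nhdsWithin] with y hy hxy
  rw [slope_def_field] at hy
  by_contra! hle
  exact hy.not_ge (div_nonneg_of_nonpos (sub_nonpos.2 hle) (sub_neg.2 hxy).le)

theorem pos_of_deriv_neg_of_nonpos {y : ℝ → ℝ} {a b : ℝ} (hy : ContinuousOn y (Icc a b))
    (hb : 0 ≤ y b) (hd : ∀ x ∈ Ioo a b, y x ≤ 0 → ∃ y' < 0, HasDerivAt y y' x) :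
    ∀ x ∈ Ioo a b, 0 < y x := by
  intro x₀ hx₀
  by_contra! hle
  -- Past a point where `y ≤ 0`, the minimum of `y` would be attained at an interior point.
  obtain ⟨y', hy', hder⟩ := hd x₀ hx₀ hle
  obtain ⟨x₁, hlt₁, hx₁⟩ := ((eventually_lt_right_of_deriv_neg hder hy').and
    (Ioo_mem_nhdsGT hx₀.2)).exists
  obtain ⟨x, hx, hmin⟩ := isCompact_Icc.exists_isMinOn (nonempty_Icc.2 hx₀.2.le)
    (hy.mono (Icc_subset_Icc_left hx₀.1.le))
  have hxx₁ : y x ≤ y x₁ := hmin (Ioo_subset_Icc_self hx₁)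
  have hxb : x < b := lt_of_le_of_ne hx.2 fun h => by subst h; linarith
  obtain ⟨z', hz', hderx⟩ := hd x ⟨hx₀.1.trans_le hx.1, hxb⟩ (by linarith)
  obtain ⟨z, hltz, hz⟩ := ((eventually_lt_right_of_deriv_neg hderx hz').and
    (Ioo_mem_nhdsGT hxb)).exists
  exact hltz.not_ge (hmin ⟨hx.1.trans hz.1.le, hz.2.le⟩)

theorem nonpos_of_tendsto_atBot {w : ℝ → ℝ} {α : ℝ} (hw : ContinuousOn w (Iic α))
    (hlim : Tendsto w atBot (𝓝 0))
    (hd : ∀ x < α, 0 < w x → ∃ w', HasDerivAt w w' x ∧ w' ≤ 0) {x : ℝ} (hx : x ≤ α) :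
    w x ≤ 0 := by
  refine le_of_forall_pos_le_add fun ε hε => ?_
  obtain ⟨N, hN, hNx⟩ := ((hlim.eventually_lt_const hε).and (eventually_le_atBot x)).exists
  rw [zero_add]
  exact le_of_deriv_nonpos_above hNx (hw.mono fun t ht => ht.2.trans hx) hN.le
    fun t ht h => hd t (ht.2.trans_le hx) (hε.trans h)

theorem hasDerivAt_of_eventually_ne {f g : ℝ → ℝ} {x : ℝ}
    (hd : ∀ᶠ y in 𝓝[≠] x, HasDerivAt f (g y) y) (hf : ContinuousAt f x) (hg : ContinuousAt g x) :
    HasDerivAt f (g x) x := by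
  have hdiff : {y | y ≠ x → HasDerivAt f (g y) y} ∈ 𝓝 x := eventually_nhdsWithin_iff.1 hd
  have hderiv : Tendsto (deriv f) (𝓝[≠] x) (𝓝 (g x)) :=
    (hg.mono_left nhdsWithin_le_nhds).congr' (hd.mono fun y hy => hy.deriv.symm)
  have hright : HasDerivWithinAt f (g x) (Ici x) x := by
    refine hasDerivWithinAt_Ici_of_tendsto_deriv (s := Ioi x ∩ {y | y ≠ x → HasDerivAt f (g y) y})
      (fun y hy => (hy.2 hy.1.ne').differentiableAt.differentiableWithinAt)
      hf.continuousWithinAt (inter_mem_nhdsWithin _ hdiff)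
      (hderiv.mono_left (nhdsGT_le_nhdsNE x))
  have hleft : HasDerivWithinAt f (g x) (Iic x) x := by
    refine hasDerivWithinAt_Iic_of_tendsto_deriv (s := Iio x ∩ {y | y ≠ x → HasDerivAt f (g y) y})
      (fun y hy => (hy.2 hy.1.ne).differentiableAt.differentiableWithinAt)
      hf.continuousWithinAt (inter_mem_nhdsWithin _ hdiff)
      (hderiv.mono_left (nhdsLT_le_nhdsNE x))
  simpa using hleft.union hright

/-! ### Backward solutions of scalar equations -/

/-- `z` solves the terminal value problem `z' = F(x, z)` on `(a, b)`, `z(b) = z₀`, and is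
continuous up to both end points; `F` may be singular there. -/
structure IsBackwardSolution (F : ℝ → ℝ → ℝ) (a b z₀ : ℝ) (z : ℝ → ℝ) : Prop where
  continuousOn : ContinuousOn z (Icc a b)
  terminal : z b = z₀
  hasDerivAt : ∀ x ∈ Ioo a b, HasDerivAt z (F x (z x)) x

namespace IsBackwardSolution

theorem of_tendstoUniformlyOn {F : ℝ → ℝ → ℝ} {Fn : ℕ → ℝ → ℝ → ℝ} {zn : ℕ → ℝ → ℝ}
    {z : ℝ → ℝ} {a b z₀ : ℝ} (hab : a ≤ b) (hzn : ∀ n, IsBackwardSolution (Fn n) a b z₀ (zn n))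
    (hz : TendstoUniformlyOn zn z atTop (Icc a b))
    (hF : TendstoUniformlyOn (fun n x => Fn n x (zn n x)) (fun x => F x (z x)) atTop (Ioo a b)) :
    IsBackwardSolution F a b z₀ z where
  continuousOn := hz.continuousOn (Frequently.of_forall fun n => (hzn n).continuousOn)
  terminal := tendsto_nhds_unique (hz.tendsto_at (right_mem_Icc.2 hab))
    (tendsto_const_nhds.congr fun n => ((hzn n).terminal).symm)
  hasDerivAt := fun _ hx => hasDerivAt_of_tendstoUniformlyOn isOpen_Ioo hF
    (.of_forall fun n => (hzn n).hasDerivAt)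
    (fun _ hy => hz.tendsto_at (Ioo_subset_Icc_self hy)) hx

theorem sub_le {k A ρ ρ' z z' : ℝ → ℝ} {a b z₀ κ δ : ℝ} (hδ : 0 ≤ δ)
    (hk : ∀ x ∈ Icc a b, k x ∈ Icc 0 κ) (hρ : Monotone ρ) (hρ' : ∀ s, ρ' s ≤ ρ s + δ)
    (hz : IsBackwardSolution (fun x y => k x * ρ (y - A x)) a b z₀ z)
    (hz' : IsBackwardSolution (fun x y => k x * ρ' (y - A x)) a b z₀ z') :
    ∀ x ∈ Icc a b, z x - z' x ≤ κ * δ * (b - a) := by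
  intro x hx
  have hκ : 0 ≤ κ * δ := mul_nonneg ((hk x hx).1.trans (hk x hx).2) hδ
  have hgrowth : z x - z' x ≤ 0 + κ * δ * (b - x) := by
    refine le_add_of_le_deriv_above (w := fun y => z y - z' y) hx.2 hκ
      ((hz.continuousOn.sub hz'.continuousOn).mono (Icc_subset_Icc_left hx.1))
      (by rw [hz.terminal, hz'.terminal, sub_self]) fun y hy hpos => ?_
    have hyo : y ∈ Ioo a b := ⟨hx.1.trans_lt hy.1, hy.2⟩
    refine ⟨_, (hz.hasDerivAt y hyo).fun_sub (hz'.hasDerivAt y hyo), ?_⟩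
    obtain ⟨hk0, hkκ⟩ := hk y (Ioo_subset_Icc_self hyo)
    have hρzz' : ρ' (z' y - A y) ≤ ρ (z y - A y) + δ :=
      (hρ' _).trans (by gcongr; exact hρ (by linarith))
    have := mul_le_mul_of_nonneg_left hρzz' hk0
    have := mul_le_mul_of_nonneg_right hkκ hδ
    linarith
  have := mul_le_mul_of_nonneg_left (sub_le_sub_left hx.1 b) hκ
  linarith

theorem exists_of_lipschitz {k A ρ : ℝ → ℝ} {a b B : ℝ} {K : NNReal} (hab : a ≤ b)
    (hk : ContinuousOn k (Icc a b)) (hA : ContinuousOn A (Icc a b)) (hρ : LipschitzWith K ρ)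
    (hB : ∀ s, |ρ s| ≤ B) (z₀ : ℝ) :
    ∃ z, IsBackwardSolution (fun x y => k x * ρ (y - A x)) a b z₀ z := by
  obtain ⟨κ, hκ⟩ := isCompact_Icc.exists_bound_of_continuousOn hk
  lift B to NNReal using (abs_nonneg _).trans (hB 0)
  lift κ to NNReal using (norm_nonneg _).trans (hκ a (left_mem_Icc.2 hab))
  have hPL : IsPicardLindelof (fun x y => k x * ρ (y - A x)) (⟨b, right_mem_Icc.2 hab⟩ : Icc a b)
      z₀ (κ * B * (b - a).toNNReal) 0 (κ * B) (κ * K) := by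
    refine ⟨fun x hx => ?_, fun y _ => ?_, fun x hx y _ => ?_, by simp [hab]⟩
    · refine (LipschitzWith.of_dist_le_mul fun y y' => ?_).lipschitzOnWith
      have hρyy' := hρ.dist_le_mul (y - A x) (y' - A x)
      rw [dist_sub_right] at hρyy'
      rw [Real.dist_eq, ← mul_sub, abs_mul, ← Real.dist_eq (ρ _), NNReal.coe_mul, mul_assoc]
      exact mul_le_mul (hκ x hx) hρyy' dist_nonneg κ.2
    · exact hk.mul (hρ.continuous.comp_continuousOn (continuousOn_const.sub hA))
    · rw [norm_mul]
      exact mul_le_mul (hκ x hx) (hB _) (norm_nonneg _) κ.2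
  obtain ⟨z, hzb, hz⟩ := hPL.exists_eq_forall_mem_Icc_hasDerivWithinAt₀
  exact ⟨z, fun x hx => (hz x hx).continuousWithinAt, hzb, fun x hx =>
    (hz x (Ioo_subset_Icc_self hx)).hasDerivAt (Icc_mem_nhds hx.1 hx.2)⟩

end IsBackwardSolution

theorem tendstoUniformlyOn_mul_comp {k w ρ : ℝ → ℝ} {wn ρn : ℕ → ℝ → ℝ} {s : Set ℝ} {κ : ℝ}
    (hk : ∀ x ∈ s, |k x| ≤ κ) (hρ : UniformContinuous ρ) (hρn : TendstoUniformly ρn ρ atTop)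
    (hwn : TendstoUniformlyOn wn w atTop s) :
    TendstoUniformlyOn (fun n x => k x * ρn n (wn n x)) (fun x => k x * ρ (w x)) atTop s := by
  rw [Metric.tendstoUniformlyOn_iff]
  intro ε hε
  have hκ : 0 < 2 * (|κ| + 1) := by positivity
  filter_upwards [Metric.tendstoUniformly_iff.1 hρn _ (div_pos hε hκ),
    Metric.tendstoUniformlyOn_iff.1 (hρ.comp_tendstoUniformlyOn hwn) _ (div_pos hε hκ)]
    with n hnear hcomp x hx
  have hdist : dist (ρ (w x)) (ρn n (wn n x)) ≤ ε / (|κ| + 1) :=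
    calc dist (ρ (w x)) (ρn n (wn n x))
        ≤ dist (ρ (w x)) (ρ (wn n x)) + dist (ρ (wn n x)) (ρn n (wn n x)) := dist_triangle _ _ _
      _ ≤ ε / (2 * (|κ| + 1)) + ε / (2 * (|κ| + 1)) := (add_lt_add (hcomp x hx) (hnear _)).le
      _ = ε / (|κ| + 1) := by field_simp; norm_num
  rw [Real.dist_eq] at hdist ⊢
  rw [← mul_sub, abs_mul]
  calc |k x| * |ρ (w x) - ρn n (wn n x)| ≤ |κ| * (ε / (|κ| + 1)) :=
        mul_le_mul ((hk x hx).trans (le_abs_self κ)) hdist (abs_nonneg _) (abs_nonneg _)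
    _ < ε := by
        rw [mul_div_assoc', div_lt_iff₀ (by positivity), mul_comm]
        gcongr
        linarith

theorem uniformCauchySeqOn_backward {k A ρ : ℝ → ℝ} {ρn zn : ℕ → ℝ → ℝ} {a b z₀ κ : ℝ}
    (hab : a ≤ b) (hk : ∀ x ∈ Icc a b, k x ∈ Icc 0 κ) (hmono : ∀ n, Monotone (ρn n))
    (hρn : TendstoUniformly ρn ρ atTop)
    (hzn : ∀ n, IsBackwardSolution (fun x y => k x * ρn n (y - A x)) a b z₀ (zn n)) :
    UniformCauchySeqOn zn atTop (Icc a b) := by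
  rw [Metric.uniformCauchySeqOn_iff]
  intro ε hε
  have hκ : 0 ≤ κ * (b - a) := by
    have := hk a (left_mem_Icc.2 hab)
    exact mul_nonneg (this.1.trans this.2) (sub_nonneg.2 hab)
  set δ := ε / (2 * (κ * (b - a) + 1)) with hδ
  have hδ0 : 0 < δ := by positivity
  obtain ⟨N, hN⟩ := eventually_atTop.1 (Metric.tendstoUniformly_iff.1 hρn δ hδ0)
  have hsub : ∀ m ≥ N, ∀ n ≥ N, ∀ x ∈ Icc a b, zn m x - zn n x < ε := fun m hm n hn x hx => by
    have hle := (hzn m).sub_le (δ := 2 * δ) (by positivity) hk (hmono m) (fun s => by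
      have hms := abs_lt.1 (hN m hm s)
      have hns := abs_lt.1 (hN n hn s)
      linarith [hms.2, hns.1]) (hzn n) x hx
    refine hle.trans_lt ?_
    rw [show κ * (2 * δ) * (b - a) = κ * (b - a) * ε / (κ * (b - a) + 1) by rw [hδ]; field_simp,
      div_lt_iff₀ (by positivity)]
    linarith
  refine ⟨N, fun m hm n hn x hx => abs_lt.2 ⟨?_, hsub m hm n hn x hx⟩⟩
  linarith [hsub n hn m hm x hx]

theorem IsBackwardSolution.exists_of_monotone_approx {k A ρ : ℝ → ℝ} {ρn : ℕ → ℝ → ℝ} {a b : ℝ}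
    (hab : a ≤ b) (hk : ContinuousOn k (Icc a b)) (hk0 : ∀ x ∈ Icc a b, 0 ≤ k x)
    (hA : ContinuousOn A (Icc a b)) (hmono : ∀ n, Monotone (ρn n))
    (hlip : ∀ n, ∃ K, LipschitzWith K (ρn n)) (hbdd : ∀ n, ∃ B, ∀ s, |ρn n s| ≤ B)
    (hρn : TendstoUniformly ρn ρ atTop) (z₀ : ℝ) :
    ∃ z, IsBackwardSolution (fun x y => k x * ρ (y - A x)) a b z₀ z := by
  obtain ⟨κ, hκ⟩ := isCompact_Icc.exists_bound_of_continuousOn hk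
  choose K hK using hlip
  choose B hB using hbdd
  choose zn hzn using fun n => exists_of_lipschitz hab hk hA (hK n) (hB n) z₀
  have hcauchy := uniformCauchySeqOn_backward hab
    (fun x hx => ⟨hk0 x hx, (le_abs_self _).trans (hκ x hx)⟩) hmono hρn hzn
  choose! z hz using fun x (hx : x ∈ Icc a b) =>
    cauchySeq_tendsto_of_complete (hcauchy.cauchySeq hx)
  have hunif : TendstoUniformlyOn zn z atTop (Icc a b) := hcauchy.tendstoUniformlyOn_of_tendsto hz
  have hshift : TendstoUniformlyOn (fun n x => zn n x - A x) (fun x => z x - A x) atTop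
      (Icc a b) := by
    simpa [Metric.tendstoUniformlyOn_iff, dist_sub_right] using hunif
  exact ⟨z, of_tendstoUniformlyOn hab hzn hunif <|
    (tendstoUniformlyOn_mul_comp hκ
      (hρn.uniformContinuous (.of_forall fun n => (hK n).uniformContinuous)) hρn hshift).mono
      Ioo_subset_Icc_self⟩

/-! ### Exponents and the constant `k(p)` -/

theorem one_lt_conj {p : ℝ} (hp : 1 < p) : 1 < conj p := by
  rw [conj, one_lt_div (by linarith)]
  linarith

theorem conj_sub_one_mul {p : ℝ} (hp : 1 < p) : (conj p - 1) * (p - 1) = 1 := by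
  have : p - 1 ≠ 0 := by linarith
  rw [conj]
  field_simp
  ring

theorem one_add_rpow_le {a q : ℝ} (ha : 0 < a) (hq1 : 1 ≤ q) (hq2 : q ≤ 2) :
    (1 + a) ^ q ≤ 1 + q * a + a ^ q := by
  have hadd : (1 + a) ^ (q - 1) ≤ 1 + a ^ (q - 1) := by
    simpa using Real.rpow_add_le_add_rpow zero_le_one ha.le (p := q - 1) (by linarith) (by linarith)
  have hbernoulli : (1 + a) ^ (q - 1) ≤ 1 + (q - 1) * a :=
    rpow_one_add_le_one_add_mul_self (by linarith) (by linarith) (by linarith)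
  calc (1 + a) ^ q = (1 + a) ^ (q - 1) + a * (1 + a) ^ (q - 1) := by
        rw [Real.rpow_sub_one (by positivity)]
        field_simp
    _ ≤ 1 + (q - 1) * a + a * (1 + a ^ (q - 1)) := by gcongr
    _ = 1 + q * a + a ^ q := by
        rw [Real.rpow_sub_one ha.ne']
        field_simp
        ring

theorem kConst_mem_Ioc {p : ℝ} (hp : 1 < p) : kConst p ∈ Ioc 0 1 := by
  have hq := one_lt_conj hp
  have hqp := conj_sub_one_mul hp
  rw [kConst]
  split_ifs with hlt heq
  · have hq2 : 1 ≤ conj p - 1 := by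
      by_contra! hlt'
      nlinarith
    have htwo : (2 : ℝ) ≤ 2 ^ (conj p - 1) := by
      simpa using Real.rpow_le_rpow_of_exponent_le one_le_two hq2
    have hden : (1 : ℝ) ≤ 2 ^ (conj p - 1) - 1 := by linarith
    exact ⟨by positivity, (div_le_one (by linarith)).2 hden⟩
  · exact ⟨zero_lt_one, le_rfl⟩
  · have hp2 : 2 < p := lt_of_le_of_ne (not_lt.1 hlt) (Ne.symm heq)
    have hq2 : conj p ≤ 2 := by
      by_contra! hlt'
      nlinarith
    set q := conj p
    set a := (q - 1) ^ (1 / (q - 2)) with ha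
    have ha0 : 0 < a := Real.rpow_pos_of_pos (by linarith) _
    have haq : (q - 1) ^ (q / (q - 2)) = a ^ q := by
      rw [ha, ← Real.rpow_mul (by linarith), one_div_mul_eq_div]
    rw [haq]
    have hratio : 1 ≤ (1 + q * a + a ^ q) / (1 + a) ^ q :=
      (one_le_div (by positivity)).2 (one_add_rpow_le ha0 hq.le hq2)
    have hden : q ≤ q - 1 + (1 + q * a + a ^ q) / (1 + a) ^ q := by linarith
    have hden0 : 0 < q - 1 + (1 + q * a + a ^ q) / (1 + a) ^ q := by linarith
    exact ⟨div_pos (by linarith) hden0, (div_le_one hden0).2 hden⟩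

/-! ### Truncated powers -/

/-- The power `s ^ e` truncated to `0 ≤ s ≤ M`, with its argument shifted by `δ`: for `δ > 0` it is
Lipschitz, and it tends to the truncated power uniformly as `δ → 0`. -/
noncomputable def truncPow (M e δ s : ℝ) : ℝ := (max 0 (min M s) + δ) ^ e

section TruncPow

variable {M e δ s : ℝ}

theorem truncPow_nonneg (hδ : 0 ≤ δ) : 0 ≤ truncPow M e δ s := by
  unfold truncPow
  positivity

theorem truncPow_zero_of_mem_Icc (hs : s ∈ Icc 0 M) : truncPow M e 0 s = s ^ e := by
  rw [truncPow, min_eq_right hs.2, max_eq_right hs.1, add_zero]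

theorem truncPow_zero_of_nonpos (he : e ≠ 0) (hM : 0 ≤ M) (hs : s ≤ 0) : truncPow M e 0 s = 0 := by
  rw [truncPow, min_eq_right (hs.trans hM), max_eq_left hs, add_zero, Real.zero_rpow he]

theorem monotone_truncPow (he : 0 ≤ e) (hδ : 0 ≤ δ) : Monotone (truncPow M e δ) :=
  fun _ _ hst => Real.rpow_le_rpow (by positivity) (by gcongr) he

theorem abs_truncPow_le (he : 0 ≤ e) (hM : 0 ≤ M) (hδ : 0 ≤ δ) (s : ℝ) :
    |truncPow M e δ s| ≤ (M + δ) ^ e := by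
  rw [abs_of_nonneg (truncPow_nonneg hδ)]
  exact Real.rpow_le_rpow (by positivity) (by gcongr; exact max_le hM (min_le_left M s)) he

theorem exists_lipschitzWith_truncPow (hM : 0 ≤ M) (hδ : 0 < δ) :
    ∃ K, LipschitzWith K (truncPow M e δ) := by
  have hpow : ContDiffOn ℝ 1 (fun x : ℝ => x ^ e) (Icc δ (M + δ)) :=
    contDiffOn_id.rpow_const_of_ne fun x hx => (hδ.trans_le hx.1).ne'
  obtain ⟨K, hK⟩ := hpow.exists_lipschitzOnWith one_ne_zero (convex_Icc _ _) isCompact_Icc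
  have hclamp : LipschitzWith 1 fun s => max 0 (min M s) + δ := by
    simpa using ((LipschitzWith.id.const_min M).const_max 0).add (LipschitzWith.const δ)
  refine ⟨K * 1, lipschitzOnWith_univ.1 (hK.comp hclamp.lipschitzOnWith fun s _ => ⟨?_, ?_⟩)⟩
  · exact le_add_of_nonneg_left (le_max_left _ _)
  · gcongr
    exact max_le hM (min_le_left M s)

theorem tendstoUniformly_truncPow (he : 0 < e) (he1 : e ≤ 1) :
    TendstoUniformly (fun n : ℕ => truncPow M e (1 / ((n : ℝ) + 1))) (truncPow M e 0) atTop := by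
  have hzero : Tendsto (fun n : ℕ => (1 / ((n : ℝ) + 1)) ^ e) atTop (𝓝 0) := by
    simpa [Real.zero_rpow he.ne'] using
      (tendsto_one_div_add_atTop_nhds_zero_nat (𝕜 := ℝ)).rpow_const (Or.inr he.le)
  rw [Metric.tendstoUniformly_iff]
  intro ε hε
  filter_upwards [hzero.eventually_lt_const hε] with n hn s
  have hshift : 0 ≤ 1 / ((n : ℝ) + 1) := by positivity
  have hclamp : 0 ≤ max 0 (min M s) := le_max_left _ _
  have hle : truncPow M e 0 s ≤ truncPow M e (1 / ((n : ℝ) + 1)) s :=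
    Real.rpow_le_rpow (by positivity) (by gcongr) he.le
  have hsub := Real.rpow_add_le_add_rpow hclamp hshift he.le he1
  rw [dist_comm, Real.dist_eq, abs_of_nonneg (sub_nonneg.2 hle), truncPow, truncPow, add_zero]
  linarith

theorem IsBackwardSolution.exists_truncPow {k A : ℝ → ℝ} {a b : ℝ} (he : 0 < e) (he1 : e ≤ 1)
    (hM : 0 ≤ M) (hab : a ≤ b) (hk : ContinuousOn k (Icc a b)) (hk0 : ∀ x ∈ Icc a b, 0 ≤ k x)
    (hA : ContinuousOn A (Icc a b)) (z₀ : ℝ) :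
    ∃ z, IsBackwardSolution (fun x y => k x * truncPow M e 0 (y - A x)) a b z₀ z := by
  have hpos : ∀ n : ℕ, (0 : ℝ) < 1 / ((n : ℝ) + 1) := fun n => Nat.one_div_pos_of_nat
  exact exists_of_monotone_approx hab hk hk0 hA (fun n => monotone_truncPow he.le (hpos n).le)
    (fun n => exists_lipschitzWith_truncPow hM (hpos n))
    (fun n => ⟨_, abs_truncPow_le he.le hM (hpos n).le⟩) (tendstoUniformly_truncPow he he1) z₀

end TruncPow

/-! ### Primitives -/

section Primitive

variable {r : ℝ → ℝ} {a b x : ℝ}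

theorem continuousOn_primitive_Icc (hab : a ≤ b)
    (hint : IntervalIntegrable r MeasureTheory.volume a b) :
    ContinuousOn (fun x => ∫ u in a..x, r u) (Icc a b) := by
  rw [← uIcc_of_le hab]
  exact intervalIntegral.continuousOn_primitive_interval' hint left_mem_uIcc

theorem hasDerivAt_primitive_of_continuousOn_Ioo (hr : ContinuousOn r (Ioo a b))
    (hint : IntervalIntegrable r MeasureTheory.volume a b) (hx : x ∈ Ioo a b) :
    HasDerivAt (fun x => ∫ u in a..x, r u) (r x) x :=
  intervalIntegral.integral_hasDerivAt_right
    (hint.mono_set (uIcc_subset_uIcc_left (Icc_subset_uIcc (Ioo_subset_Icc_self hx))))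
    (hr.stronglyMeasurableAtFilter isOpen_Ioo x hx) (hr.continuousAt (isOpen_Ioo.mem_nhds hx))

theorem primitive_pos (hint : IntervalIntegrable r MeasureTheory.volume a b)
    (hpos : ∀ u ∈ Ioo a b, 0 < r u) (hx : x ∈ Ioc a b) : 0 < ∫ u in a..x, r u :=
  intervalIntegral.intervalIntegral_pos_of_pos_on
    (hint.mono_set (uIcc_subset_uIcc_left (Icc_subset_uIcc (Ioc_subset_Icc_self hx))))
    (fun _ hu => hpos _ ⟨hu.1, hu.2.trans_le hx.2⟩) hx.1

theorem primitive_nonneg (hint : IntervalIntegrable r MeasureTheory.volume a b)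
    (hpos : ∀ u ∈ Ioo a b, 0 < r u) (hx : x ∈ Icc a b) : 0 ≤ ∫ u in a..x, r u := by
  rcases hx.1.eq_or_lt with rfl | hax
  · rw [intervalIntegral.integral_same]
  · exact (primitive_pos hint hpos ⟨hax, hx.2⟩).le

end Primitive

/-! ### The convective flux -/

section ConvFlux

variable {f : ℝ → ℝ} {x : ℝ}

theorem convFlux_zero (f : ℝ → ℝ) : convFlux f 0 = 0 := intervalIntegral.integral_same

theorem continuousOn_convFlux (hf : ContinuousOn f (Icc 0 1)) :
    ContinuousOn (convFlux f) (Icc 0 1) :=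
  continuousOn_primitive_Icc zero_le_one (hf.intervalIntegrable_of_Icc zero_le_one)

theorem hasDerivAt_convFlux (hf : ContinuousOn f (Icc 0 1)) (hx : x ∈ Ioo 0 1) :
    HasDerivAt (convFlux f) (f x) x :=
  hasDerivAt_primitive_of_continuousOn_Ioo (hf.mono Ioo_subset_Icc_self)
    (hf.intervalIntegrable_of_Icc zero_le_one) hx

theorem convFlux_const_add (c : ℝ) (hf : ContinuousOn f (Icc 0 1)) (hx : x ∈ Icc 0 1) :
    convFlux (fun s => c + f s) x = c * x + convFlux f x := by
  have hint := (hf.mono (Icc_subset_Icc_right hx.2)).intervalIntegrable_of_Icc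
    (μ := MeasureTheory.volume) hx.1
  rw [convFlux, intervalIntegral.integral_add intervalIntegrable_const hint,
    intervalIntegral.integral_const, sub_zero, smul_eq_mul, mul_comm, convFlux]

theorem convFlux_nonneg (hf0 : ∀ s ∈ Icc 0 1, 0 ≤ f s) (hx : x ∈ Icc 0 1) : 0 ≤ convFlux f x :=
  intervalIntegral.integral_nonneg hx.1 fun s hs => hf0 s ⟨hs.1, hs.2.trans hx.2⟩

end ConvFlux

/-! ### The power of the flux beyond the ignition threshold -/

/-- `y` is the `q`-th power of a solution `v > 0` of `v' = f - r v ^ (1 - q)` on `(a, b)` with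
`v(b) = 0`. Unlike the equation for `v`, that for `y` is regular where `y` vanishes. -/
structure IsPowerFlux (q : ℝ) (f r : ℝ → ℝ) (a b : ℝ) (y : ℝ → ℝ) : Prop
    extends IsBackwardSolution (fun x y => q * (f x * y ^ ((q - 1) / q) - r x)) a b 0 y where
  pos : ∀ x ∈ Ioo a b, 0 < y x

section PowerFlux

variable {q a b M : ℝ} {f r y : ℝ → ℝ}

theorem IsBackwardSolution.le_integral {F : ℝ → ℝ → ℝ} (hq : 0 ≤ q) (hab : a ≤ b)
    (hr : ContinuousOn r (Ioo a b)) (hr0 : ∀ x ∈ Ioo a b, 0 < r x)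
    (hint : IntervalIntegrable r MeasureTheory.volume a b) (hy : IsBackwardSolution F a b 0 y)
    (hF : ∀ x ∈ Ioo a b, -(q * r x) ≤ F x (y x)) :
    ∀ x ∈ Icc a b, y x ≤ q * ∫ u in a..b, r u := by
  intro x hx
  have hsum := le_add_of_le_deriv_above (w := fun x => y x + q * ∫ u in a..x, r u)
    (m := q * ∫ u in a..b, r u) hx.2 le_rfl
    ((hy.continuousOn.add (continuousOn_const.mul (continuousOn_primitive_Icc hab hint))).mono
      (Icc_subset_Icc_left hx.1)) (by rw [hy.terminal, zero_add]) fun t ht _ => by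
      have ht' : t ∈ Ioo a b := ⟨hx.1.trans_lt ht.1, ht.2⟩
      refine ⟨_, (hy.hasDerivAt t ht').fun_add
        ((hasDerivAt_primitive_of_continuousOn_Ioo hr hint ht').const_mul q), ?_⟩
      linarith [hF t ht']
  have := mul_nonneg hq (primitive_nonneg hint hr0 hx)
  linarith

theorem exists_truncated_powerFlux (hq : 1 < q) (hM : 0 ≤ M) (hab : a ≤ b)
    (hf : ContinuousOn f (Icc a b)) (hf0 : ∀ x ∈ Icc a b, 0 ≤ f x)
    (hr : ContinuousOn r (Ioo a b)) (hint : IntervalIntegrable r MeasureTheory.volume a b) :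
    ∃ y, IsBackwardSolution
      (fun x y => q * (f x * truncPow M ((q - 1) / q) 0 y - r x)) a b 0 y := by
  have hq0 : 0 < q := by linarith
  have hP : ContinuousOn (fun x => q * ∫ u in a..x, r u) (Icc a b) :=
    continuousOn_const.mul (continuousOn_primitive_Icc hab hint)
  obtain ⟨z, hz⟩ := IsBackwardSolution.exists_truncPow (e := (q - 1) / q)
    (div_pos (by linarith) hq0) ((div_le_one hq0).2 (by linarith)) hM hab
    (k := fun x => q * f x) (continuousOn_const.mul hf) (fun x hx => mul_nonneg hq0.le (hf0 x hx))
    hP (q * ∫ u in a..b, r u)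
  refine ⟨fun x => z x - q * ∫ u in a..x, r u, hz.continuousOn.sub hP, sub_eq_zero.2 hz.terminal,
    fun x hx => ?_⟩
  exact ((hz.hasDerivAt x hx).fun_sub
    ((hasDerivAt_primitive_of_continuousOn_Ioo hr hint hx).const_mul q)).congr_deriv (by ring)

theorem exists_powerFlux (hq : 1 < q) (hab : a < b)
    (hf : ContinuousOn f (Icc a b)) (hf0 : ∀ x ∈ Icc a b, 0 ≤ f x)
    (hr : ContinuousOn r (Ioo a b)) (hr0 : ∀ x ∈ Ioo a b, 0 < r x)
    (hint : IntervalIntegrable r MeasureTheory.volume a b) :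
    ∃ y, IsPowerFlux q f r a b y := by
  have hq0 : 0 < q := by linarith
  have he : 0 < (q - 1) / q := div_pos (by linarith) hq0
  have hM : 0 ≤ q * ∫ u in a..b, r u :=
    mul_nonneg hq0.le (primitive_nonneg hint hr0 (right_mem_Icc.2 hab.le))
  obtain ⟨y, hy⟩ := exists_truncated_powerFlux hq hM hab.le hf hf0 hr hint
  have hle := hy.le_integral hq0.le hab.le hr hr0 hint fun x hx => by
    have := mul_nonneg (hf0 x (Ioo_subset_Icc_self hx)) (truncPow_nonneg (M := q * ∫ u in a..b, r u)
      (e := (q - 1) / q) (s := y x) le_rfl)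
    nlinarith
  have hpos := pos_of_deriv_neg_of_nonpos hy.continuousOn hy.terminal.ge fun x hx hneg => by
    refine ⟨_, ?_, hy.hasDerivAt x hx⟩
    rw [truncPow_zero_of_nonpos he.ne' hM hneg, mul_zero, zero_sub]
    exact mul_neg_of_pos_of_neg hq0 (neg_neg_of_pos (hr0 x hx))
  refine ⟨y, ⟨hy.continuousOn, hy.terminal, fun x hx => ?_⟩, hpos⟩
  rw [← truncPow_zero_of_mem_Icc ⟨(hpos x hx).le, hle x (Ioo_subset_Icc_self hx)⟩]
  exact hy.hasDerivAt x hx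

namespace IsPowerFlux

theorem nonneg_left (hab : a < b) (hy : IsPowerFlux q f r a b y) : 0 ≤ y a := by
  have hlim : Tendsto y (𝓝[>] a) (𝓝 (y a)) :=
    (hy.continuousOn a (left_mem_Icc.2 hab.le)).mono_of_mem_nhdsWithin (Icc_mem_nhdsGT hab)
  refine ge_of_tendsto hlim ?_
  filter_upwards [Ioo_mem_nhdsGT hab] with x hx using (hy.pos x hx).le

theorem le_integral (hq : 1 < q) (hab : a ≤ b) (hf0 : ∀ x ∈ Icc a b, 0 ≤ f x)
    (hr : ContinuousOn r (Ioo a b)) (hr0 : ∀ x ∈ Ioo a b, 0 < r x)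
    (hint : IntervalIntegrable r MeasureTheory.volume a b) (hy : IsPowerFlux q f r a b y) :
    ∀ x ∈ Icc a b, y x ≤ q * ∫ u in a..b, r u :=
  hy.toIsBackwardSolution.le_integral (by linarith) hab hr hr0 hint fun x hx => by
    have := mul_nonneg (hf0 x (Ioo_subset_Icc_self hx))
      (Real.rpow_nonneg (hy.pos x hx).le ((q - 1) / q))
    nlinarith

theorem sub_le {f₁ f₂ y₁ y₂ : ℝ → ℝ} {δ : ℝ} (hq : 1 < q) (hab : a ≤ b) (hδ : 0 ≤ δ)
    (hM : 0 ≤ M) (hf0 : ∀ x ∈ Icc a b, 0 ≤ f₁ x) (hf : ∀ x ∈ Icc a b, f₂ x ≤ f₁ x + δ)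
    (h₁ : IsPowerFlux q f₁ r a b y₁) (h₂ : IsPowerFlux q f₂ r a b y₂)
    (hle : ∀ x ∈ Icc a b, y₂ x ≤ M) :
    y₁ a - y₂ a ≤ q * M ^ ((q - 1) / q) * δ * (b - a) := by
  have he : 0 ≤ (q - 1) / q := div_nonneg (by linarith) (by linarith)
  have hgrowth := le_add_of_le_deriv_above (w := fun x => y₁ x - y₂ x) (m := 0)
    (κ := q * M ^ ((q - 1) / q) * δ) hab (by positivity)
    (h₁.continuousOn.sub h₂.continuousOn) (by rw [h₁.terminal, h₂.terminal, sub_zero])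
    fun x hx hpos => by
      refine ⟨_, (h₁.hasDerivAt x hx).fun_sub (h₂.hasDerivAt x hx), ?_⟩
      have hxI := Ioo_subset_Icc_self hx
      have hy₂ := (h₂.pos x hx).le
      have hmono : y₂ x ^ ((q - 1) / q) ≤ y₁ x ^ ((q - 1) / q) :=
        Real.rpow_le_rpow hy₂ (by linarith) he
      have hbound : y₂ x ^ ((q - 1) / q) ≤ M ^ ((q - 1) / q) := Real.rpow_le_rpow hy₂ (hle x hxI) he
      have hconv : f₂ x * y₂ x ^ ((q - 1) / q) ≤
          f₁ x * y₁ x ^ ((q - 1) / q) + δ * M ^ ((q - 1) / q) :=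
        calc f₂ x * y₂ x ^ ((q - 1) / q) ≤ (f₁ x + δ) * y₂ x ^ ((q - 1) / q) := by
              gcongr; exact hf x hxI
          _ ≤ f₁ x * y₁ x ^ ((q - 1) / q) + δ * M ^ ((q - 1) / q) := by
              rw [add_mul]; gcongr; exact hf0 x hxI
      nlinarith
  linarith

theorem hasDerivAt_rpow (hq : 1 < q) (hy : IsPowerFlux q f r a b y) {x : ℝ} (hx : x ∈ Ioo a b) :
    HasDerivAt (fun x => y x ^ (1 / q)) (f x - r x * (y x ^ (1 / q)) ^ (1 - q)) x := by
  have hq0 : q ≠ 0 := by linarith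
  have hy0 := hy.pos x hx
  have hne : y x ^ ((q - 1) / q) ≠ 0 := (Real.rpow_pos_of_pos hy0 _).ne'
  have hexp : y x ^ (1 / q - 1) = (y x ^ ((q - 1) / q))⁻¹ := by
    rw [← Real.rpow_neg hy0.le]
    congr 1
    rw [div_sub_one hq0, ← neg_div, neg_sub]
  have hexp' : (y x ^ (1 / q)) ^ (1 - q) = (y x ^ ((q - 1) / q))⁻¹ := by
    rw [← Real.rpow_mul hy0.le, ← hexp, one_div_mul_eq_div, div_sub_one hq0]
  convert (hy.hasDerivAt x hx).rpow_const (p := 1 / q) (Or.inl hy0.ne') using 1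
  rw [hexp, hexp']
  field_simp

theorem rpow_le_of_hasDerivAt {W : ℝ → ℝ} (hq : 1 < q) (hr0 : ∀ x ∈ Ioo a b, 0 < r x)
    (hW : ContinuousOn W (Icc a b)) (hW' : ∀ x ∈ Ioo a b, HasDerivAt W (f x) x)
    (hy : IsPowerFlux q f r a b y) (hle : y a ^ (1 / q) ≤ W a) :
    ∀ x ∈ Icc a b, y x ^ (1 / q) ≤ W x := by
  intro x hx
  have hq0 : 0 < 1 / q := by positivity
  refine sub_nonpos.1 (le_of_deriv_nonpos_above (w := fun x => y x ^ (1 / q) - W x) hx.1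
    (((hy.continuousOn.rpow_const fun _ _ => Or.inr hq0.le).sub hW).mono
      (Icc_subset_Icc_right hx.2)) (sub_nonpos.2 hle) fun t ht _ => ?_)
  have ht' : t ∈ Ioo a b := ⟨ht.1, ht.2.trans_le hx.2⟩
  refine ⟨_, (hy.hasDerivAt_rpow hq ht').fun_sub (hW' t ht'), ?_⟩
  have hv := Real.rpow_nonneg (Real.rpow_nonneg (hy.pos t ht').le (1 / q)) (1 - q)
  have := mul_nonneg (hr0 t ht').le hv
  linarith

theorem lt_rpow_of_hasDerivAt {W : ℝ → ℝ} (hq : 1 < q) (hab : a < b)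
    (hf0 : ∀ x ∈ Icc a b, 0 ≤ f x) (hr : ContinuousOn r (Ioo a b)) (hr0 : ∀ x ∈ Ioo a b, 0 < r x)
    (hint : IntervalIntegrable r MeasureTheory.volume a b)
    (hW : ContinuousOn W (Icc a b)) (hW' : ∀ x ∈ Ioo a b, HasDerivAt W (f x) x)
    (hWb : W b ^ q < q * ∫ u in a..b, r u) (hy : IsPowerFlux q f r a b y) :
    W a < y a ^ (1 / q) := by
  by_contra! hle
  have hq0 : 0 < q := by linarith
  have hya := hy.nonneg_left hab
  have hvW := hy.rpow_le_of_hasDerivAt hq hr0 hW hW' hle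
  have hyW : y a ≤ W a ^ q := by
    simpa [← Real.rpow_mul hya, hq0.ne'] using Real.rpow_le_rpow (Real.rpow_nonneg hya _) hle hq0.le
  have henergy : y b - W b ^ q + q * ∫ u in a..b, r u ≤ 0 := by
    refine le_of_deriv_nonpos_above (w := fun x => y x - W x ^ q + q * ∫ u in a..x, r u) hab.le
      ((hy.continuousOn.sub (hW.rpow_const fun _ _ => Or.inr hq0.le)).add
        (continuousOn_const.mul (continuousOn_primitive_Icc hab.le hint)))
      (by simpa using hyW) fun x hx _ => ?_
    refine ⟨_, ((hy.hasDerivAt x hx).fun_sub ((hW' x hx).rpow_const (Or.inr hq.le))).fun_add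
      ((hasDerivAt_primitive_of_continuousOn_Ioo hr hint hx).const_mul q), ?_⟩
    have hxI := Ioo_subset_Icc_self hx
    have hy0 := (hy.pos x hx).le
    have hpow : y x ^ ((q - 1) / q) ≤ W x ^ (q - 1) := by
      have := Real.rpow_le_rpow (Real.rpow_nonneg hy0 _) (hvW x hxI) (by linarith : 0 ≤ q - 1)
      rwa [← Real.rpow_mul hy0, one_div_mul_eq_div] at this
    have := mul_le_mul_of_nonneg_left hpow (mul_nonneg hq0.le (hf0 x hxI))
    linarith
  linarith [hy.terminal]

end IsPowerFlux

end PowerFlux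

/-! ### Ignition nonlinearities -/

/-- `g` is a reaction term on the open interval `(0,1)` with ignition threshold `θ`. -/
structure IsIgnition (θ : ℝ) (g : ℝ → ℝ) : Prop where
  mem_Ioo : θ ∈ Ioo 0 1
  eq_zero : ∀ u ∈ Ioc 0 θ, g u = 0
  pos : ∀ u ∈ Ioo θ 1, 0 < g u

/-- The weight `D ^ (p' - 1) g` that the reaction `g` contributes to the equation for the flux. -/
noncomputable def reaction (p : ℝ) (D g : ℝ → ℝ) (u : ℝ) : ℝ := D u ^ (conj p - 1) * g u

section Ignition

variable {p θ : ℝ} {D g r : ℝ → ℝ}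

theorem IsIgnition.nonneg (hg : IsIgnition θ g) : ∀ u ∈ Ioo 0 1, 0 ≤ g u := fun u hu => by
  rcases le_or_gt u θ with hle | hlt
  · rw [hg.eq_zero u ⟨hu.1, hle⟩]
  · exact (hg.pos u ⟨hlt, hu.2⟩).le

theorem IsIgnition.reaction (hg : IsIgnition θ g) (hD : ∀ u ∈ Ioo 0 1, 0 < D u) :
    IsIgnition θ (reaction p D g) where
  mem_Ioo := hg.mem_Ioo
  eq_zero u hu := by rw [TravelingWave.reaction, hg.eq_zero u hu, mul_zero]
  pos u hu :=
    mul_pos (Real.rpow_pos_of_pos (hD u ⟨hg.mem_Ioo.1.trans hu.1, hu.2⟩) _) (hg.pos u hu)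

theorem continuousOn_reaction (hD : ContinuousOn D (Ioo 0 1)) (hD0 : ∀ u ∈ Ioo 0 1, 0 < D u)
    (hg : ContinuousOn g (Ioo 0 1)) : ContinuousOn (reaction p D g) (Ioo 0 1) :=
  (hD.rpow_const fun u hu => Or.inl (hD0 u hu).ne').mul hg

theorem IsIgnition.integral_eq (hr : IsIgnition θ r)
    (hint : IntervalIntegrable r MeasureTheory.volume 0 1) :
    ∫ u in (0 : ℝ)..1, r u = ∫ u in θ..1, r u := by
  have hθ : θ ∈ uIcc 0 1 := Icc_subset_uIcc (Ioo_subset_Icc_self hr.mem_Ioo)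
  rw [← intervalIntegral.integral_add_adjacent_intervals
    (hint.mono_set (uIcc_subset_uIcc_left hθ)) (hint.mono_set (uIcc_subset_uIcc_right hθ)),
    intervalIntegral.integral_zero_ae (.of_forall fun u hu => hr.eq_zero u ?_), zero_add]
  rwa [uIoc_of_le hr.mem_Ioo.1.le] at hu

theorem IsIgnition.integral_pos (hr : IsIgnition θ r)
    (hint : IntervalIntegrable r MeasureTheory.volume 0 1) : 0 < ∫ u in (0 : ℝ)..1, r u := by
  rw [hr.integral_eq hint]
  exact primitive_pos (hint.mono_set (uIcc_subset_uIcc_right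
    (Icc_subset_uIcc (Ioo_subset_Icc_self hr.mem_Ioo)))) hr.pos (right_mem_Ioc.2 hr.mem_Ioo.2)

end Ignition

/-! ### The shooting argument -/

/-- `V` is the flux of a front, up to sign, as a function of the concentration in `[0,1]`. Here `f`
is the convective velocity in the moving frame, `r` the `reaction`, and `q` the conjugate
exponent. -/
structure IsFrontFlux (q : ℝ) (f r V : ℝ → ℝ) : Prop where
  continuousOn : ContinuousOn V (Icc 0 1)
  zero : V 0 = 0
  one : V 1 = 0
  pos : ∀ x ∈ Ioo 0 1, 0 < V x
  hasDerivAt : ∀ x ∈ Ioo 0 1, HasDerivAt V (f x - r x * V x ^ (1 - q)) x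

section Shooting

variable {q θ : ℝ} {f k r V y : ℝ → ℝ}

theorem IsFrontFlux.eq_convFlux (hf : ContinuousOn f (Icc 0 1)) (hr : IsIgnition θ r)
    (hV : IsFrontFlux q f r V) : ∀ s ∈ Icc 0 θ, V s = convFlux f s := fun s hs => by
  have hs1 := hs.2.trans_lt hr.mem_Ioo.2
  rw [convFlux, intervalIntegral.integral_eq_sub_of_hasDerivAt_of_le hs.1
    (hV.continuousOn.mono (Icc_subset_Icc_right hs1.le)) (fun x hx => ?_)
    ((hf.mono (Icc_subset_Icc_right hs1.le)).intervalIntegrable_of_Icc hs.1), hV.zero, sub_zero]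
  have hderiv := hV.hasDerivAt x ⟨hx.1, hx.2.trans hs1⟩
  rwa [hr.eq_zero x ⟨hx.1, hx.2.le.trans hs.2⟩, zero_mul, sub_zero] at hderiv

theorem IsPowerFlux.lipschitzOnWith_left {a b M C : ℝ} {Y : ℝ → ℝ → ℝ} (hq : 1 < q) (hab : a ≤ b)
    (hM : 0 ≤ M) (hk0 : ∀ x ∈ Icc a b, 0 ≤ k x)
    (hY : ∀ c ∈ Icc 0 C, IsPowerFlux q (fun s => c + k s) r a b (Y c))
    (hle : ∀ c ∈ Icc 0 C, ∀ x ∈ Icc a b, Y c x ≤ M) :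
    LipschitzOnWith (q * M ^ ((q - 1) / q) * (b - a)).toNNReal (fun c => Y c a) (Icc 0 C) :=
  LipschitzOnWith.of_le_add_mul' _ fun c hc c' hc' => by
    have hsub := IsPowerFlux.sub_le (δ := dist c c') hq hab dist_nonneg hM
      (fun x hx => add_nonneg hc.1 (hk0 x hx))
      (fun x _ => by
        have := (abs_le.1 (Real.dist_eq c c').ge).1
        linarith) (hY c hc) (hY c' hc') (hle c' hc')
    linarith

theorem IsPowerFlux.exists_speed {a b : ℝ} {W : ℝ → ℝ} (hq : 1 < q) (ha : 0 < a) (hab : a < b)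
    (hk : ContinuousOn k (Icc a b)) (hk0 : ∀ x ∈ Icc a b, 0 ≤ k x)
    (hr : ContinuousOn r (Ioo a b)) (hr0 : ∀ x ∈ Ioo a b, 0 < r x)
    (hint : IntervalIntegrable r MeasureTheory.volume a b)
    (hW : ContinuousOn W (Icc a b)) (hW' : ∀ x ∈ Ioo a b, HasDerivAt W (k x) x) (hWa : 0 ≤ W a)
    (hWb : W b ^ q < q * ∫ u in a..b, r u) :
    ∃ c y, 0 < c ∧ IsPowerFlux q (fun s => c + k s) r a b y ∧ y a ^ (1 / q) = c * a + W a := by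
  set M := q * ∫ u in a..b, r u
  have hM : 0 ≤ M := mul_nonneg (by linarith) (primitive_nonneg hint hr0 (right_mem_Icc.2 hab.le))
  have hMq : 0 ≤ M ^ (1 / q) := Real.rpow_nonneg hM _
  set C := M ^ (1 / q) / a
  have hC : 0 ≤ C := div_nonneg hMq ha.le
  have hf0 : ∀ c ∈ Icc 0 C, ∀ x ∈ Icc a b, 0 ≤ c + k x :=
    fun c hc x hx => add_nonneg hc.1 (hk0 x hx)
  choose! Y hY using fun c (hc : c ∈ Icc 0 C) =>
    exists_powerFlux hq hab (continuousOn_const.add hk) (hf0 c hc) hr hr0 hint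
  have hle : ∀ c ∈ Icc 0 C, ∀ x ∈ Icc a b, Y c x ≤ M :=
    fun c hc => (hY c hc).le_integral hq hab.le (hf0 c hc) hr hr0 hint
  have hcont : ContinuousOn (fun c => Y c a ^ (1 / q) - (c * a + W a)) (Icc 0 C) :=
    ((lipschitzOnWith_left hq hab.le hM hk0 hY hle).continuousOn.rpow_const
      fun _ _ => Or.inr (by positivity)).sub (by fun_prop)
  have hzero : W a < Y 0 a ^ (1 / q) :=
    (hY 0 ⟨le_rfl, hC⟩).lt_rpow_of_hasDerivAt hq hab (hf0 0 ⟨le_rfl, hC⟩) hr hr0 hint hW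
      (fun x hx => by simpa using hW' x hx) hWb
  have hlast : Y C a ^ (1 / q) ≤ C * a + W a := by
    rw [div_mul_cancel₀ _ ha.ne']
    have hCI := right_mem_Icc.2 hC
    have hpow := Real.rpow_le_rpow ((hY C hCI).nonneg_left hab)
      (hle C hCI a (left_mem_Icc.2 hab.le)) (by positivity : 0 ≤ 1 / q)
    linarith
  obtain ⟨c, hc, hmatch⟩ := intermediate_value_Icc' hC hcont
    (show (0 : ℝ) ∈ _ from ⟨by linarith, by simpa using hzero.le⟩)
  refine ⟨c, Y c, hc.1.lt_of_ne ?_, hY c hc, sub_eq_zero.1 hmatch⟩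
  rintro rfl
  dsimp only at hmatch
  linarith

theorem IsFrontFlux.of_hasDerivAt_of_ne (hf : ContinuousOn f (Ioo 0 1))
    (hr : ContinuousOn r (Ioo 0 1)) (hV : ContinuousOn V (Icc 0 1)) (hV0 : V 0 = 0) (hV1 : V 1 = 0)
    (hpos : ∀ x ∈ Ioo 0 1, 0 < V x)
    (hderiv : ∀ x ∈ Ioo 0 1, x ≠ θ → HasDerivAt V (f x - r x * V x ^ (1 - q)) x) :
    IsFrontFlux q f r V where
  continuousOn := hV
  zero := hV0
  one := hV1
  pos := hpos
  hasDerivAt x hx := by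
    rcases eq_or_ne x θ with rfl | hne
    · have hVx := hV.continuousAt (Icc_mem_nhds hx.1 hx.2)
      have hI := isOpen_Ioo.mem_nhds hx
      refine hasDerivAt_of_eventually_ne (g := fun s => f s - r s * V s ^ (1 - q)) ?_ hVx
        ((hf.continuousAt hI).sub
          ((hr.continuousAt hI).mul (hVx.rpow_const (.inl (hpos x hx).ne'))))
      filter_upwards [self_mem_nhdsWithin, mem_nhdsWithin_of_mem_nhds hI] with s hs hsI
        using hderiv s hsI hs
    · exact hderiv x hx hne

theorem IsPowerFlux.isFrontFlux_ite (hq : 1 < q) (hf : ContinuousOn f (Icc 0 1))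
    (hf0 : ∀ s ∈ Ioo 0 1, 0 < f s) (hr : IsIgnition θ r) (hrc : ContinuousOn r (Ioo 0 1))
    (hy : IsPowerFlux q f r θ 1 y) (hyθ : y θ ^ (1 / q) = convFlux f θ) :
    IsFrontFlux q f r fun s => if s ≤ θ then convFlux f s else y s ^ (1 / q) := by
  obtain ⟨hθ0, hθ1⟩ := hr.mem_Ioo
  set V : ℝ → ℝ := fun s => if s ≤ θ then convFlux f s else y s ^ (1 / q)
  have hleft : ∀ s ≤ θ, V s = convFlux f s := fun s hs => if_pos hs
  have hright : ∀ s, θ ≤ s → V s = y s ^ (1 / q) := fun s hs => by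
    rcases hs.eq_or_lt with rfl | hlt
    · rw [hleft _ le_rfl, hyθ]
    · exact if_neg hlt.not_ge
  have hpos : ∀ x ∈ Ioo 0 1, 0 < V x := fun x hx => by
    rcases le_or_gt x θ with hle | hlt
    · rw [hleft x hle]
      exact primitive_pos (hf.intervalIntegrable_of_Icc zero_le_one) hf0 (Ioo_subset_Ioc_self hx)
    · rw [hright x hlt.le]
      exact Real.rpow_pos_of_pos (hy.pos x ⟨hlt, hx.2⟩) _
  have hcont : ContinuousOn V (Icc 0 1) := by
    rw [← Icc_union_Icc_eq_Icc hθ0.le hθ1.le]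
    exact (((continuousOn_convFlux hf).mono (Icc_subset_Icc_right hθ1.le)).congr
      fun s hs => hleft s hs.2).union_of_isClosed
      ((hy.continuousOn.rpow_const fun _ _ => Or.inr (by positivity)).congr
        fun s hs => hright s hs.1) isClosed_Icc isClosed_Icc
  have hderiv : ∀ x ∈ Ioo 0 1, x ≠ θ → HasDerivAt V (f x - r x * V x ^ (1 - q)) x := by
    intro x hx hne
    rcases hne.lt_or_gt with hlt | hgt
    · rw [hr.eq_zero x ⟨hx.1, hlt.le⟩, zero_mul, sub_zero]
      refine (hasDerivAt_convFlux hf hx).congr_of_eventuallyEq ?_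
      filter_upwards [Iio_mem_nhds hlt] with s hs using hleft s (le_of_lt hs)
    · rw [hright x hgt.le]
      refine (hy.hasDerivAt_rpow hq ⟨hgt, hx.2⟩).congr_of_eventuallyEq ?_
      filter_upwards [Ioi_mem_nhds hgt] with s hs using hright s (le_of_lt hs)
  refine .of_hasDerivAt_of_ne (hf.mono Ioo_subset_Icc_self) hrc hcont
    (by rw [hleft 0 hθ0.le, convFlux_zero]) ?_ hpos hderiv
  rw [hright 1 hθ1.le, hy.terminal, Real.zero_rpow (by positivity)]

theorem exists_frontFlux (hq : 1 < q) (hk : ContinuousOn k (Icc 0 1))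
    (hk0 : ∀ s ∈ Icc 0 1, 0 ≤ k s) (hr : IsIgnition θ r) (hrc : ContinuousOn r (Ioo 0 1))
    (hint : IntervalIntegrable r MeasureTheory.volume 0 1)
    (hH : convFlux k 1 ^ q < q * ∫ u in (0 : ℝ)..1, r u) :
    ∃ c V, 0 < c ∧ IsFrontFlux q (fun s => c + k s) r V := by
  obtain ⟨hθ0, hθ1⟩ := hr.mem_Ioo
  have hsub : Icc θ 1 ⊆ Icc 0 1 := Icc_subset_Icc_left hθ0.le
  have hintθ : IntervalIntegrable r MeasureTheory.volume θ 1 := hint.mono_set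
    (uIcc_subset_uIcc_right (Icc_subset_uIcc ⟨hθ0.le, hθ1.le⟩))
  rw [hr.integral_eq hint] at hH
  obtain ⟨c, y, hc, hy, hyθ⟩ := IsPowerFlux.exists_speed hq hθ0 hθ1 (hk.mono hsub)
    (fun x hx => hk0 x (hsub hx)) (hrc.mono (Ioo_subset_Ioo_left hθ0.le)) hr.pos hintθ
    ((continuousOn_convFlux hk).mono hsub)
    (fun x hx => hasDerivAt_convFlux hk ⟨hθ0.trans hx.1, hx.2⟩)
    (convFlux_nonneg hk0 ⟨hθ0.le, hθ1.le⟩) hH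
  rw [← convFlux_const_add c hk (Ioo_subset_Icc_self hr.mem_Ioo)] at hyθ
  exact ⟨c, _, hc, hy.isFrontFlux_ite hq (continuousOn_const.add hk)
    (fun s hs => add_pos_of_pos_of_nonneg hc (hk0 s (Ioo_subset_Icc_self hs))) hr hrc hyθ⟩

end Shooting

/-! ### Inverting the arrival time -/

/-- The decreasing profile that passes the level `s ∈ (0,1)` at the time `T s`. The point `0` is
inserted because the supremum of the empty set should be the equilibrium `0`. -/
noncomputable def profileOf (T : ℝ → ℝ) (ξ : ℝ) : ℝ := sSup (insert 0 {s | s ∈ Ioo 0 1 ∧ ξ < T s})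

section ProfileOf

variable {T : ℝ → ℝ} {s ξ : ℝ}

theorem profileOf_mem_Icc (T : ℝ → ℝ) (ξ : ℝ) : profileOf T ξ ∈ Icc 0 1 := by
  have hle : ∀ s ∈ insert 0 {s | s ∈ Ioo 0 1 ∧ ξ < T s}, s ≤ 1 := by
    rintro s (rfl | hs)
    exacts [zero_le_one, hs.1.2.le]
  exact ⟨le_csSup ⟨1, hle⟩ (mem_insert _ _), csSup_le (insert_nonempty _ _) hle⟩

theorem lt_profileOf_iff (hT : StrictAntiOn T (Ioo 0 1)) (hTc : ContinuousOn T (Ioo 0 1))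
    (hs : s ∈ Ioo 0 1) : s < profileOf T ξ ↔ ξ < T s := by
  constructor <;> intro hlt
  · contrapose! hlt
    refine csSup_le (insert_nonempty _ _) ?_
    rintro t (rfl | ⟨ht, hξt⟩)
    · exact hs.1.le
    · exact ((hT.lt_iff_gt hs ht).1 (hlt.trans_lt hξt)).le
  · have hev := (hTc.continuousAt (isOpen_Ioo.mem_nhds hs)).eventually_const_lt hlt
    obtain ⟨t, ⟨hξt, htI⟩, hst⟩ := (((hev.and (isOpen_Ioo.eventually_mem hs)).filter_mono
      nhdsWithin_le_nhds).and (self_mem_nhdsWithin (s := Ioi s))).exists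
    refine lt_of_lt_of_le hst (le_csSup ⟨1, ?_⟩ (mem_insert_of_mem _ ⟨htI, hξt⟩))
    rintro r (rfl | hr)
    exacts [zero_le_one, hr.1.2.le]

theorem profileOf_le_iff (hT : StrictAntiOn T (Ioo 0 1)) (hTc : ContinuousOn T (Ioo 0 1))
    (hs : s ∈ Ioo 0 1) : profileOf T ξ ≤ s ↔ T s ≤ ξ := by
  rw [← not_lt, lt_profileOf_iff hT hTc hs, not_lt]

theorem apply_profileOf (hT : StrictAntiOn T (Ioo 0 1)) (hTc : ContinuousOn T (Ioo 0 1))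
    (h : profileOf T ξ ∈ Ioo 0 1) : T (profileOf T ξ) = ξ := by
  refine le_antisymm ((profileOf_le_iff hT hTc h).1 le_rfl) (ge_of_tendsto
    ((hTc.continuousAt (isOpen_Ioo.mem_nhds h)).mono_left
      (nhdsWithin_le_nhds (s := Iio (profileOf T ξ)))) ?_)
  filter_upwards [Ioo_mem_nhdsLT h.1] with s hs
  exact ((lt_profileOf_iff hT hTc ⟨hs.1, hs.2.trans h.2⟩).1 hs.2).le

theorem continuous_profileOf (hT : StrictAntiOn T (Ioo 0 1)) (hTc : ContinuousOn T (Ioo 0 1)) :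
    Continuous (profileOf T) := by
  refine continuous_iff_continuousAt.2 fun ξ => tendsto_order.2 ⟨fun a ha => ?_, fun a ha => ?_⟩
  · rcases lt_or_ge a 0 with h0 | h0
    · exact .of_forall fun η => h0.trans_le (profileOf_mem_Icc T η).1
    obtain ⟨s, has, hs⟩ := exists_between ha
    have hsI : s ∈ Ioo 0 1 := ⟨h0.trans_lt has, hs.trans_le (profileOf_mem_Icc T ξ).2⟩
    filter_upwards [Iio_mem_nhds ((lt_profileOf_iff hT hTc hsI).1 hs)] with η hη
      using has.trans ((lt_profileOf_iff hT hTc hsI).2 hη)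
  · rcases lt_or_ge 1 a with h1 | h1
    · exact .of_forall fun η => (profileOf_mem_Icc T η).2.trans_lt h1
    obtain ⟨s, hs, hsa⟩ := exists_between ha
    obtain ⟨t, ht, hts⟩ := exists_between hs
    have htI : t ∈ Ioo 0 1 := ⟨(profileOf_mem_Icc T ξ).1.trans_lt ht, (hts.trans hsa).trans_le h1⟩
    have hsI : s ∈ Ioo 0 1 := ⟨htI.1.trans hts, hsa.trans_le h1⟩
    have hTs : T s < ξ := (hT htI hsI hts).trans_le ((profileOf_le_iff hT hTc htI).1 ht.le)
    filter_upwards [Ioi_mem_nhds hTs] with η hη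
      using ((profileOf_le_iff hT hTc hsI).2 (le_of_lt hη)).trans_lt hsa

theorem tendsto_profileOf_atBot (hT : StrictAntiOn T (Ioo 0 1)) (hTc : ContinuousOn T (Ioo 0 1)) :
    Tendsto (profileOf T) atBot (𝓝 1) := by
  refine tendsto_order.2 ⟨fun a ha => ?_, fun a ha => .of_forall fun ξ =>
    (profileOf_mem_Icc T ξ).2.trans_lt ha⟩
  obtain ⟨s, hs, hs1⟩ := exists_between (max_lt ha zero_lt_one)
  obtain ⟨has, hs0⟩ := max_lt_iff.1 hs
  filter_upwards [Iio_mem_atBot (T s)] with ξ hξ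
    using has.trans ((lt_profileOf_iff hT hTc ⟨hs0, hs1⟩).2 hξ)

theorem tendsto_profileOf_atTop (hT : StrictAntiOn T (Ioo 0 1)) (hTc : ContinuousOn T (Ioo 0 1)) :
    Tendsto (profileOf T) atTop (𝓝 0) := by
  refine tendsto_order.2 ⟨fun a ha => .of_forall fun ξ => ha.trans_le (profileOf_mem_Icc T ξ).1,
    fun a ha => ?_⟩
  obtain ⟨s, hs0, hs⟩ := exists_between (lt_min ha zero_lt_one)
  obtain ⟨hsa, hs1⟩ := lt_min_iff.1 hs
  filter_upwards [Ici_mem_atTop (T s)] with ξ hξ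
    using ((profileOf_le_iff hT hTc ⟨hs0, hs1⟩).2 hξ).trans_lt hsa

end ProfileOf

/-! ### The profile with a given flux -/

section InteriorSet

variable {p ξ : ℝ} {D u : ℝ → ℝ}

theorem isOpen_interiorSet (hu : Continuous u) : IsOpen (interiorSet u) :=
  isOpen_Ioo.preimage hu

theorem eq_zero_or_eq_one_of_notMem_interiorSet (hu : u ξ ∈ Icc 0 1) (hξ : ξ ∉ interiorSet u) :
    u ξ = 0 ∨ u ξ = 1 := by
  rcases hu.1.eq_or_lt with h0 | h0
  · exact .inl h0.symm
  · exact .inr (hu.2.antisymm (not_lt.1 fun h1 => hξ ⟨h0, h1⟩))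

theorem diffFlux_of_mem (hξ : ξ ∈ interiorSet u) :
    diffFlux p D u ξ = D (u ξ) * |deriv u ξ| ^ (p - 2) * deriv u ξ :=
  indicator_of_mem hξ _

theorem diffFlux_of_notMem (hξ : ξ ∉ interiorSet u) : diffFlux p D u ξ = 0 :=
  indicator_of_notMem hξ _

end InteriorSet

section PowerLaw

variable {p d v w u' : ℝ}

theorem powerLaw_neg_rpow (hp : 1 < p) (hd : 0 < d) (hv : 0 < v) :
    d * |-(v / d) ^ (conj p - 1)| ^ (p - 2) * -(v / d) ^ (conj p - 1) = -v := by
  have hr : 0 < (v / d) ^ (conj p - 1) := Real.rpow_pos_of_pos (div_pos hv hd) _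
  have hinv : ((v / d) ^ (conj p - 1)) ^ (p - 2) * (v / d) ^ (conj p - 1) = v / d := by
    rw [← Real.rpow_add_one hr.ne', ← Real.rpow_mul (div_pos hv hd).le,
      show p - 2 + 1 = p - 1 by ring, conj_sub_one_mul hp, Real.rpow_one]
  rw [abs_neg, abs_of_pos hr, mul_neg, mul_assoc, hinv, mul_div_cancel₀ _ hd.ne']

theorem neg_powerLaw_div_rpow (hp : 1 < p) (hd : 0 < d) (hu : u' < 0) :
    (-(d * |u'| ^ (p - 2) * u') / d) ^ (conj p - 1) = -u' := by
  have h0 : 0 < -u' := neg_pos.2 hu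
  have hpow : -(d * |u'| ^ (p - 2) * u') / d = (-u') ^ (p - 1) := by
    rw [abs_of_neg hu, show p - 1 = p - 2 + 1 by ring, Real.rpow_add_one h0.ne']
    field_simp
  rw [hpow, ← Real.rpow_mul h0.le, mul_comm, conj_sub_one_mul hp, Real.rpow_one]

theorem reaction_mul_rpow {D g : ℝ → ℝ} {s : ℝ} (hD : 0 < D s) (hv : 0 ≤ v) (hw : 0 ≤ w) :
    reaction p D g s * w ^ (1 - conj p) * (v / D s) ^ (conj p - 1) =
      g s * (v / w) ^ (conj p - 1) := by
  have hDq : D s ^ (conj p - 1) ≠ 0 := (Real.rpow_pos_of_pos hD _).ne'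
  rw [reaction, ← neg_sub (conj p), Real.rpow_neg hw, Real.div_rpow hv hD.le, Real.div_rpow hv hw]
  field_simp

end PowerLaw

/-- The speed `-u'` at which a profile `u` with flux `-V` decreases when it passes `s`. -/
noncomputable def decayRate (p : ℝ) (D V : ℝ → ℝ) (s : ℝ) : ℝ := (V s / D s) ^ (conj p - 1)

/-- The time at which the profile with flux `-V` passes `s`, if it passes `1 / 2` at time `0`. -/
noncomputable def arrivalTime (p : ℝ) (D V : ℝ → ℝ) (s : ℝ) : ℝ :=
  ∫ t in s..(1 / 2), (decayRate p D V t)⁻¹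

section ArrivalTime

variable {p q s ξ : ℝ} {D f r V : ℝ → ℝ}

theorem decayRate_pos (hD0 : ∀ s ∈ Ioo 0 1, 0 < D s) (hV : IsFrontFlux q f r V)
    (hs : s ∈ Ioo 0 1) : 0 < decayRate p D V s :=
  Real.rpow_pos_of_pos (div_pos (hV.pos s hs) (hD0 s hs)) _

theorem continuousOn_decayRate (hD : ContinuousOn D (Ioo 0 1)) (hD0 : ∀ s ∈ Ioo 0 1, 0 < D s)
    (hV : IsFrontFlux q f r V) : ContinuousOn (decayRate p D V) (Ioo 0 1) :=
  ((hV.continuousOn.mono Ioo_subset_Icc_self).div hD fun s hs => (hD0 s hs).ne').rpow_const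
    fun s hs => Or.inl (div_pos (hV.pos s hs) (hD0 s hs)).ne'

theorem hasDerivAt_arrivalTime (hD : ContinuousOn D (Ioo 0 1)) (hD0 : ∀ s ∈ Ioo 0 1, 0 < D s)
    (hV : IsFrontFlux q f r V) (hs : s ∈ Ioo 0 1) :
    HasDerivAt (arrivalTime p D V) (-(decayRate p D V s)⁻¹) s := by
  have hcont : ContinuousOn (fun t => (decayRate p D V t)⁻¹) (Ioo 0 1) :=
    (continuousOn_decayRate hD hD0 hV).inv₀ fun t ht => (decayRate_pos hD0 hV ht).ne'
  exact intervalIntegral.integral_hasDerivAt_left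
    (hcont.mono (ordConnected_Ioo.uIcc_subset hs (by norm_num))).intervalIntegrable
    (hcont.stronglyMeasurableAtFilter isOpen_Ioo s hs)
    (hcont.continuousAt (isOpen_Ioo.mem_nhds hs))

theorem continuousOn_arrivalTime (hD : ContinuousOn D (Ioo 0 1)) (hD0 : ∀ s ∈ Ioo 0 1, 0 < D s)
    (hV : IsFrontFlux q f r V) : ContinuousOn (arrivalTime p D V) (Ioo 0 1) := fun _ hs =>
  (hasDerivAt_arrivalTime hD hD0 hV hs).continuousAt.continuousWithinAt

theorem strictAntiOn_arrivalTime (hD : ContinuousOn D (Ioo 0 1)) (hD0 : ∀ s ∈ Ioo 0 1, 0 < D s)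
    (hV : IsFrontFlux q f r V) : StrictAntiOn (arrivalTime p D V) (Ioo 0 1) :=
  strictAntiOn_of_deriv_neg (convex_Ioo _ _) (continuousOn_arrivalTime hD hD0 hV) fun s hs => by
    rw [interior_Ioo] at hs
    rw [(hasDerivAt_arrivalTime hD hD0 hV hs).deriv]
    exact neg_lt_zero.2 (inv_pos.2 (decayRate_pos hD0 hV hs))

theorem hasDerivAt_profileOf_arrivalTime (hD : ContinuousOn D (Ioo 0 1))
    (hD0 : ∀ s ∈ Ioo 0 1, 0 < D s) (hV : IsFrontFlux q f r V)
    (hξ : ξ ∈ interiorSet (profileOf (arrivalTime p D V))) :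
    HasDerivAt (profileOf (arrivalTime p D V))
      (-decayRate p D V (profileOf (arrivalTime p D V) ξ)) ξ := by
  have hT := strictAntiOn_arrivalTime (p := p) hD hD0 hV
  have hTc := continuousOn_arrivalTime (p := p) hD hD0 hV
  have hc := continuous_profileOf hT hTc
  have hinv := HasDerivAt.of_local_left_inverse hc.continuousAt
    (hasDerivAt_arrivalTime hD hD0 hV hξ)
    (neg_ne_zero.2 (inv_pos.2 (decayRate_pos hD0 hV hξ)).ne') (by
      filter_upwards [(isOpen_interiorSet hc).mem_nhds hξ] with η hη
        using apply_profileOf hT hTc hη)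
  rwa [inv_neg, inv_inv] at hinv

theorem diffFlux_eq_of_hasDerivAt {u : ℝ → ℝ} (hp : 1 < p) (hD0 : ∀ s ∈ Ioo 0 1, 0 < D s)
    (hV : IsFrontFlux q f r V) (hu : ∀ ξ, u ξ ∈ Icc 0 1)
    (hu' : ∀ ξ ∈ interiorSet u, HasDerivAt u (-decayRate p D V (u ξ)) ξ) :
    diffFlux p D u = fun ξ => -V (u ξ) := by
  ext ξ
  by_cases hξ : ξ ∈ interiorSet u
  · rw [diffFlux_of_mem hξ, (hu' ξ hξ).deriv]
    exact powerLaw_neg_rpow hp (hD0 _ hξ) (hV.pos _ hξ)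
  · rw [diffFlux_of_notMem hξ]
    rcases eq_zero_or_eq_one_of_notMem_interiorSet (hu ξ) hξ with h0 | h1
    · rw [h0, hV.zero, neg_zero]
    · rw [h1, hV.one, neg_zero]

theorem contDiffOn_of_hasDerivAt_decayRate {u : ℝ → ℝ} (hD : ContinuousOn D (Ioo 0 1))
    (hD0 : ∀ s ∈ Ioo 0 1, 0 < D s) (hV : IsFrontFlux q f r V) (hu : Continuous u)
    (hu' : ∀ ξ ∈ interiorSet u, HasDerivAt u (-decayRate p D V (u ξ)) ξ) :
    ContDiffOn ℝ 1 u (interiorSet u) := by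
  rw [← zero_add 1, contDiffOn_succ_iff_deriv_of_isOpen (isOpen_interiorSet hu), contDiffOn_zero]
  refine ⟨fun ξ hξ => (hu' ξ hξ).differentiableAt.differentiableWithinAt, by simp, ?_⟩
  exact (((continuousOn_decayRate hD hD0 hV).comp hu.continuousOn fun _ hξ => hξ).neg).congr
    fun ξ hξ => (hu' ξ hξ).deriv

end ArrivalTime

theorem IsFrontFlux.isProfile_profileOf {p c : ℝ} {D h g V : ℝ → ℝ} (hp : 1 < p)
    (hD : ContinuousOn D (Ioo 0 1)) (hD0 : ∀ s ∈ Ioo 0 1, 0 < D s)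
    (hV : IsFrontFlux (conj p) (fun s => c + h s) (reaction p D g) V) :
    IsProfile p D h g c (profileOf (arrivalTime p D V)) := by
  have hT := strictAntiOn_arrivalTime (p := p) hD hD0 hV
  have hTc := continuousOn_arrivalTime (p := p) hD hD0 hV
  have hu := profileOf_mem_Icc (arrivalTime p D V)
  have hc := continuous_profileOf hT hTc
  have hu' := fun ξ => hasDerivAt_profileOf_arrivalTime (p := p) (ξ := ξ) hD hD0 hV
  set u := profileOf (arrivalTime p D V)
  have hflux := diffFlux_eq_of_hasDerivAt hp hD0 hV hu hu'
  have hlim : ∀ a ∈ Icc 0 1, V a = 0 → Tendsto (diffFlux p D u) (comap u (𝓝 a)) (𝓝 0) := by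
    intro a ha hVa
    rw [hflux, ← neg_zero, ← hVa]
    exact ((hV.continuousOn a ha).tendsto.comp
      (tendsto_nhdsWithin_iff.2 ⟨tendsto_comap, .of_forall hu⟩)).neg
  refine ⟨hu, hc, contDiffOn_of_hasDerivAt_decayRate hD hD0 hV hc hu', fun ξ hξ => ?_,
    hflux ▸ (hV.continuousOn.comp_continuous hc hu).neg,
    hlim 0 (left_mem_Icc.2 zero_le_one) hV.zero, hlim 1 (right_mem_Icc.2 zero_le_one) hV.one,
    tendsto_profileOf_atBot hT hTc, tendsto_profileOf_atTop hT hTc⟩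
  have hV0 := hV.pos (u ξ) hξ
  have hderiv : HasDerivAt (diffFlux p D u) _ ξ :=
    hflux ▸ ((hV.hasDerivAt (u ξ) hξ).comp ξ (hu' ξ hξ)).fun_neg
  refine ⟨hderiv.differentiableAt, ?_⟩
  have hreaction := reaction_mul_rpow (p := p) (g := g) (hD0 _ hξ) hV0.le hV0.le
  rw [div_self hV0.ne', Real.one_rpow, mul_one, ← decayRate] at hreaction
  rw [hderiv.deriv, (hu' ξ hξ).deriv]
  linarith

/-! ### The structure of an arbitrary profile -/

/-- The diffusive flux of `u` plus the convective flux with velocity `f`. Along a profile with speed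
`b` and `f = b + h`, its derivative is `-g(u)`. -/
noncomputable def totalFlux (p : ℝ) (D f u : ℝ → ℝ) (ξ : ℝ) : ℝ :=
  diffFlux p D u ξ + convFlux f (u ξ)

section Sign

variable {p ξ : ℝ} {D u : ℝ → ℝ}

theorem diffFlux_neg_iff (hD : 0 < D (u ξ)) (hξ : ξ ∈ interiorSet u) :
    diffFlux p D u ξ < 0 ↔ deriv u ξ < 0 := by
  rw [diffFlux_of_mem hξ]
  refine ⟨fun h => ?_, fun h => ?_⟩
  · by_contra! h0
    exact h.not_ge (mul_nonneg (by positivity) h0)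
  · have := abs_pos.2 h.ne
    exact mul_neg_of_pos_of_neg (by positivity) h

theorem diffFlux_pos_iff (hD : 0 < D (u ξ)) (hξ : ξ ∈ interiorSet u) :
    0 < diffFlux p D u ξ ↔ 0 < deriv u ξ := by
  rw [diffFlux_of_mem hξ]
  refine ⟨fun h => ?_, fun h => by positivity⟩
  by_contra! h0
  exact h.not_ge (mul_nonpos_of_nonneg_of_nonpos (by positivity) h0)

end Sign

namespace IsProfile

variable {p θ b ξ : ℝ} {D h g u : ℝ → ℝ}

theorem hasDerivAt (hu : IsProfile p D h g b u) (hξ : ξ ∈ interiorSet u) :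
    HasDerivAt u (deriv u ξ) ξ :=
  ((hu.contDiffOn.differentiableOn one_ne_zero).differentiableAt
    ((isOpen_interiorSet hu.continuous).mem_nhds hξ)).hasDerivAt

theorem hasDerivAt_diffFlux (hu : IsProfile p D h g b u) (hξ : ξ ∈ interiorSet u) :
    HasDerivAt (diffFlux p D u) (-(b + h (u ξ)) * deriv u ξ - g (u ξ)) ξ := by
  obtain ⟨hdiff, heq⟩ := hu.equation ξ hξ
  exact hdiff.hasDerivAt.congr_deriv (by linarith)

theorem tendsto_comp {F : ℝ → ℝ} {l : Filter ℝ} {a : ℝ} (hu : IsProfile p D h g b u)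
    (hF : ContinuousOn F (Icc 0 1)) (ha : a ∈ Icc 0 1) (hl : Tendsto u l (𝓝 a)) :
    Tendsto (fun ξ => F (u ξ)) l (𝓝 (F a)) :=
  (hF a ha).tendsto.comp (tendsto_nhdsWithin_iff.2 ⟨hl, .of_forall hu.mem_Icc⟩)

theorem exists_first_passage {s : ℝ} (hu : IsProfile p D h g b u) (hs : s ∈ Ioo 0 1) :
    ∃ α, u α = s ∧ ∀ ξ < α, s < u ξ := by
  obtain ⟨N, hN⟩ := eventually_atBot.1 (hu.tendsto_atBot.eventually_const_lt hs.2)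
  obtain ⟨M, hM⟩ := (hu.tendsto_atTop.eventually_lt_const hs.1).exists
  have hbdd : BddBelow {ξ | u ξ ≤ s} := ⟨N, fun ξ hξ => not_lt.1 fun h => (hN ξ h.le).not_ge hξ⟩
  have hmem : u (sInf {ξ | u ξ ≤ s}) ≤ s :=
    (isClosed_le hu.continuous continuous_const).csInf_mem ⟨M, hM.le⟩ hbdd
  have hbefore : ∀ ξ < sInf {ξ | u ξ ≤ s}, s < u ξ := fun ξ hξ =>
    not_le.1 fun hle => hξ.not_ge (csInf_le hbdd hle)
  refine ⟨_, hmem.antisymm ?_, hbefore⟩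
  refine ge_of_tendsto (hu.continuous.continuousAt.tendsto.mono_left
    (nhdsWithin_le_nhds (s := Iio (sInf {ξ | u ξ ≤ s})))) ?_
  filter_upwards [self_mem_nhdsWithin] with ξ hξ using (hbefore ξ hξ).le

theorem hasDerivAt_totalFlux (hh : ContinuousOn h (Icc 0 1)) (hu : IsProfile p D h g b u)
    (hξ : ξ ∈ interiorSet u) :
    HasDerivAt (totalFlux p D (fun s => b + h s) u) (-g (u ξ)) ξ :=
  ((hu.hasDerivAt_diffFlux hξ).fun_add
    ((hasDerivAt_convFlux (continuousOn_const.fun_add hh) hξ).comp ξ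
      (hu.hasDerivAt hξ))).congr_deriv (by ring)

theorem continuous_totalFlux (hh : ContinuousOn h (Icc 0 1)) (hu : IsProfile p D h g b u) :
    Continuous (totalFlux p D (fun s => b + h s) u) :=
  hu.flux_continuous.add ((continuousOn_convFlux (continuousOn_const.fun_add hh)).comp_continuous
    hu.continuous hu.mem_Icc)

theorem totalFlux_mem_of_notMem {f : ℝ → ℝ} (hu : IsProfile p D h g b u) (hξ : ξ ∉ interiorSet u) :
    totalFlux p D f u ξ ∈ ({0, convFlux f 1} : Set ℝ) := by
  rw [totalFlux, diffFlux_of_notMem hξ, zero_add]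
  rcases eq_zero_or_eq_one_of_notMem_interiorSet (hu.mem_Icc ξ) hξ with h0 | h1
  · exact .inl (h0 ▸ convFlux_zero f)
  · exact .inr (h1 ▸ rfl)

theorem antitone_totalFlux (hh : ContinuousOn h (Icc 0 1)) (hg0 : ∀ s ∈ Ioo 0 1, 0 ≤ g s)
    (hu : IsProfile p D h g b u) : Antitone (totalFlux p D (fun s => b + h s) u) := fun ξ η hξη =>
  le_of_deriv_nonpos_above_of_finite (toFinite {0, convFlux (fun s => b + h s) 1}) hξη
    (hu.continuous_totalFlux hh).continuousOn le_rfl fun x _ _ hx => by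
      have hxI : x ∈ interiorSet u := not_not.1 fun h => hx (hu.totalFlux_mem_of_notMem h)
      exact ⟨_, hu.hasDerivAt_totalFlux hh hxI, neg_nonpos.2 (hg0 _ hxI)⟩

theorem tendsto_totalFlux_atTop (hh : ContinuousOn h (Icc 0 1)) (hu : IsProfile p D h g b u) :
    Tendsto (totalFlux p D (fun s => b + h s) u) atTop (𝓝 0) := by
  have hdiff : Tendsto (diffFlux p D u) atTop (𝓝 0) :=
    hu.flux_zero.comp (tendsto_comap_iff.2 hu.tendsto_atTop : Tendsto id atTop (comap u (𝓝 0)))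
  have hconv := hu.tendsto_comp (F := convFlux fun s => b + h s)
    (continuousOn_convFlux (continuousOn_const.fun_add hh)) (left_mem_Icc.2 zero_le_one)
    hu.tendsto_atTop
  rw [convFlux_zero] at hconv
  exact add_zero (0 : ℝ) ▸ hdiff.add hconv

theorem diffFlux_neg_of_forall_lt (hD0 : ∀ s ∈ Ioo 0 1, 0 < D s) (hu : IsProfile p D h g b u)
    (hξ : ξ ∈ interiorSet u) (hgξ : 0 < g (u ξ)) (hbefore : ∀ t < ξ, u ξ < u t) :
    diffFlux p D u ξ < 0 := by
  by_contra! hflux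
  have hderiv : deriv u ξ = 0 := by
    refine le_antisymm (not_lt.1 fun hpos => ?_) (not_lt.1 fun hneg =>
      hflux.not_gt ((diffFlux_neg_iff (hD0 _ hξ) hξ).2 hneg))
    obtain ⟨t, hut, htξ⟩ := ((eventually_gt_left_of_deriv_neg (hu.hasDerivAt hξ).fun_neg
      (neg_lt_zero.2 hpos)).and self_mem_nhdsWithin).exists
    exact (hbefore t htξ).not_gt (neg_lt_neg_iff.1 hut)
  -- As `u'(ξ) = 0`, the flux has derivative `-g(u(ξ)) < 0`, so it is positive to the left of `ξ`,
  -- where `u` must therefore increase.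
  have hfluxderiv := hu.hasDerivAt_diffFlux hξ
  rw [hderiv, mul_zero, zero_sub] at hfluxderiv
  obtain ⟨l, hl, hIoo⟩ := mem_nhdsLT_iff_exists_Ioo_subset.1
    ((eventually_gt_left_of_deriv_neg hfluxderiv (neg_lt_zero.2 hgξ)).and
      (((isOpen_interiorSet hu.continuous).eventually_mem hξ).filter_mono nhdsWithin_le_nhds))
  obtain ⟨t, hlt, htξ⟩ := exists_between (mem_Iio.1 hl)
  have hmono : StrictMonoOn u (Icc t ξ) :=
    strictMonoOn_of_deriv_pos (convex_Icc _ _) hu.continuous.continuousOn fun s hs => by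
      rw [interior_Icc] at hs
      obtain ⟨hsflux, hsI⟩ := hIoo ⟨hlt.trans hs.1, hs.2⟩
      exact (diffFlux_pos_iff (hD0 _ hsI) hsI).1 (hflux.trans_lt hsflux)
  exact (hbefore t htξ).not_gt (hmono (left_mem_Icc.2 htξ.le) (right_mem_Icc.2 htξ.le) htξ)

section Ignition

variable {α : ℝ}

theorem diffFlux_neg (hD0 : ∀ s ∈ Ioo 0 1, 0 < D s) (hh : ContinuousOn h (Icc 0 1))
    (hg : IsIgnition θ g) (hu : IsProfile p D h g b u) (hξ : u ξ ∈ Ioo θ 1) :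
    diffFlux p D u ξ < 0 := by
  have hξI : u ξ ∈ Ioo 0 1 := ⟨hg.mem_Ioo.1.trans hξ.1, hξ.2⟩
  obtain ⟨α, hα, hbefore⟩ := hu.exists_first_passage hξI
  have hflux : diffFlux p D u α < 0 :=
    hu.diffFlux_neg_of_forall_lt hD0 (hα ▸ hξI : u α ∈ Ioo 0 1) (hα ▸ hg.pos _ hξ) (hα ▸ hbefore)
  have hle := hu.antitone_totalFlux hh hg.nonneg (not_lt.1 fun h => (hbefore ξ h).false)
  rw [totalFlux, totalFlux, hα] at hle
  linarith

theorem deriv_neg (hD0 : ∀ s ∈ Ioo 0 1, 0 < D s) (hh : ContinuousOn h (Icc 0 1))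
    (hg : IsIgnition θ g) (hu : IsProfile p D h g b u) (hξ : u ξ ∈ Ioo θ 1) : deriv u ξ < 0 :=
  have hξI : u ξ ∈ Ioo 0 1 := ⟨hg.mem_Ioo.1.trans hξ.1, hξ.2⟩
  (diffFlux_neg_iff (hD0 _ hξI) hξI).1 (hu.diffFlux_neg hD0 hh hg hξ)

theorem le_of_first_passage (hD0 : ∀ s ∈ Ioo 0 1, 0 < D s) (hh : ContinuousOn h (Icc 0 1))
    (hg : IsIgnition θ g) (hu : IsProfile p D h g b u) (hα : u α = θ) (hαξ : α ≤ ξ) : u ξ ≤ θ :=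
  le_of_deriv_nonpos_above_of_finite (finite_singleton 1) hαξ hu.continuous.continuousOn hα.le
    fun x _ hθx hx1 => by
      have hx : u x ∈ Ioo θ 1 := ⟨hθx, (hu.mem_Icc x).2.lt_of_ne hx1⟩
      exact ⟨_, hu.hasDerivAt ⟨hg.mem_Ioo.1.trans hθx, hx.2⟩, (hu.deriv_neg hD0 hh hg hx).le⟩

theorem totalFlux_eq_zero_of_first_passage (hD0 : ∀ s ∈ Ioo 0 1, 0 < D s)
    (hh : ContinuousOn h (Icc 0 1)) (hg : IsIgnition θ g) (hu : IsProfile p D h g b u)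
    (hα : u α = θ) (hαξ : α ≤ ξ) : totalFlux p D (fun s => b + h s) u ξ = 0 := by
  have hlim := hu.tendsto_totalFlux_atTop hh
  refine le_antisymm ?_ ((hu.antitone_totalFlux hh hg.nonneg).le_of_tendsto hlim ξ)
  refine ge_of_tendsto hlim ((eventually_ge_atTop ξ).mono fun η hξη => ?_)
  refine neg_le_neg_iff.1 (le_of_deriv_nonpos_above_of_finite
    (w := fun x => -totalFlux p D (fun s => b + h s) u x)
    (toFinite (Neg.neg '' {0, convFlux (fun s => b + h s) 1})) hξη
    (hu.continuous_totalFlux hh).neg.continuousOn le_rfl fun x hx _ hxS => ?_)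
  have hxI : x ∈ interiorSet u := not_not.1 fun h =>
    hxS (mem_image_of_mem _ (hu.totalFlux_mem_of_notMem h))
  refine ⟨_, (hu.hasDerivAt_totalFlux hh hxI).fun_neg, ?_⟩
  rw [hg.eq_zero _ ⟨hxI.1, hu.le_of_first_passage hD0 hh hg hα (hαξ.trans hx.1.le)⟩, neg_zero,
    neg_zero]

end Ignition

end IsProfile

/-! ### Uniqueness of the speed and of the profile -/

theorem eq_of_forall_mem_Ioo_lt_iff {α : Type*} [LinearOrder α] [DenselyOrdered α] {a b x y : α}
    (hx : x ∈ Icc a b) (hy : y ∈ Icc a b) (h : ∀ s ∈ Ioo a b, s < x ↔ s < y) : x = y := by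
  refine le_antisymm (not_lt.1 fun hlt => ?_) (not_lt.1 fun hlt => ?_)
  · obtain ⟨s, hys, hsx⟩ := exists_between hlt
    exact hys.not_gt ((h s ⟨hy.1.trans_lt hys, hsx.trans_le hx.2⟩).1 hsx)
  · obtain ⟨s, hxs, hsy⟩ := exists_between hlt
    exact hxs.not_gt ((h s ⟨hx.1.trans_lt hxs, hsy.trans_le hy.2⟩).2 hsy)

namespace IsProfile

variable {p θ b c α ξ : ℝ} {D h g V u : ℝ → ℝ}

theorem continuous_add_diffFlux (hu : IsProfile p D h g b u) (hV : ContinuousOn V (Icc 0 1)) :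
    Continuous fun ξ => V (u ξ) + diffFlux p D u ξ :=
  (hV.comp_continuous hu.continuous hu.mem_Icc).add hu.flux_continuous

theorem tendsto_add_diffFlux_atBot (hu : IsProfile p D h g b u) (hV : ContinuousOn V (Icc 0 1))
    (hV1 : V 1 = 0) : Tendsto (fun ξ => V (u ξ) + diffFlux p D u ξ) atBot (𝓝 0) := by
  have hflux : Tendsto (diffFlux p D u) atBot (𝓝 0) :=
    hu.flux_one.comp (tendsto_comap_iff.2 hu.tendsto_atBot : Tendsto id atBot (comap u (𝓝 1)))
  simpa only [hV1, add_zero] using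
    (hu.tendsto_comp hV (right_mem_Icc.2 zero_le_one) hu.tendsto_atBot).add hflux

theorem lt_one_of_add_diffFlux_ne_zero (hu : IsProfile p D h g b u) (hV1 : V 1 = 0)
    (hne : V (u ξ) + diffFlux p D u ξ ≠ 0) : u ξ < 1 :=
  (hu.mem_Icc ξ).2.lt_of_ne fun h1 => hne <| by
    rw [diffFlux_of_notMem fun hξ => hξ.2.ne h1, h1, hV1, add_zero]

theorem hasDerivAt_add_diffFlux (hp : 1 < p) (hD0 : ∀ s ∈ Ioo 0 1, 0 < D s)
    (hu : IsProfile p D h g b u)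
    (hV : IsFrontFlux (conj p) (fun s => c + h s) (reaction p D g) V) (hξ : ξ ∈ interiorSet u)
    (hu' : deriv u ξ < 0) :
    HasDerivAt (fun ξ => V (u ξ) + diffFlux p D u ξ)
      ((c - b) * deriv u ξ + g (u ξ) * ((-diffFlux p D u ξ / V (u ξ)) ^ (conj p - 1) - 1)) ξ := by
  have hrate := neg_powerLaw_div_rpow hp (hD0 _ hξ) hu'
  rw [← diffFlux_of_mem hξ] at hrate
  have hreaction := reaction_mul_rpow (p := p) (g := g) (hD0 _ hξ)
    (neg_pos.2 ((diffFlux_neg_iff (p := p) (hD0 _ hξ) hξ).2 hu')).le (hV.pos _ hξ).le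
  rw [hrate] at hreaction
  exact (((hV.hasDerivAt (u ξ) hξ).comp ξ (hu.hasDerivAt hξ)).fun_add
    (hu.hasDerivAt_diffFlux hξ)).congr_deriv (by linarith)

theorem add_diffFlux_nonpos (hp : 1 < p) (hD0 : ∀ s ∈ Ioo 0 1, 0 < D s)
    (hh : ContinuousOn h (Icc 0 1)) (hg : IsIgnition θ g) (hu : IsProfile p D h g b u)
    (hV : IsFrontFlux (conj p) (fun s => c + h s) (reaction p D g) V) (hbc : b ≤ c)
    (hα : ∀ t < α, θ < u t) (hξ : ξ ≤ α) : V (u ξ) + diffFlux p D u ξ ≤ 0 := by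
  refine nonpos_of_tendsto_atBot (hu.continuous_add_diffFlux hV.continuousOn).continuousOn
    (hu.tendsto_add_diffFlux_atBot hV.continuousOn hV.one) (fun t ht hpos => ?_) hξ
  have htθ : u t ∈ Ioo θ 1 := ⟨hα t ht, hu.lt_one_of_add_diffFlux_ne_zero hV.one hpos.ne'⟩
  have htI : t ∈ interiorSet u := ⟨hg.mem_Ioo.1.trans htθ.1, htθ.2⟩
  have hu' := hu.deriv_neg hD0 hh hg htθ
  have hflux := hu.diffFlux_neg hD0 hh hg htθ
  refine ⟨_, hu.hasDerivAt_add_diffFlux hp hD0 hV htI hu', ?_⟩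
  have hratio : (-diffFlux p D u t / V (u t)) ^ (conj p - 1) ≤ 1 :=
    Real.rpow_le_one (div_nonneg (neg_pos.2 hflux).le (hV.pos _ htI).le)
      ((div_le_one (hV.pos _ htI)).2 (by linarith)) (sub_pos.2 (one_lt_conj hp)).le
  exact add_nonpos (mul_nonpos_of_nonneg_of_nonpos (sub_nonneg.2 hbc) hu'.le)
    (mul_nonpos_of_nonneg_of_nonpos (hg.pos _ htθ).le (sub_nonpos.2 hratio))

theorem add_diffFlux_nonneg (hp : 1 < p) (hD0 : ∀ s ∈ Ioo 0 1, 0 < D s)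
    (hh : ContinuousOn h (Icc 0 1)) (hg : IsIgnition θ g) (hu : IsProfile p D h g b u)
    (hV : IsFrontFlux (conj p) (fun s => c + h s) (reaction p D g) V) (hcb : c ≤ b)
    (hα : ∀ t < α, θ < u t) (hξ : ξ ≤ α) : 0 ≤ V (u ξ) + diffFlux p D u ξ := by
  refine neg_nonpos.1 (nonpos_of_tendsto_atBot (w := fun ξ => -(V (u ξ) + diffFlux p D u ξ))
    (hu.continuous_add_diffFlux hV.continuousOn).neg.continuousOn
    (neg_zero (G := ℝ) ▸ (hu.tendsto_add_diffFlux_atBot hV.continuousOn hV.one).neg)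
    (fun t ht hneg => ?_) hξ)
  have hgap := neg_pos.1 hneg
  have htθ : u t ∈ Ioo θ 1 := ⟨hα t ht, hu.lt_one_of_add_diffFlux_ne_zero hV.one hgap.ne⟩
  have htI : t ∈ interiorSet u := ⟨hg.mem_Ioo.1.trans htθ.1, htθ.2⟩
  have hu' := hu.deriv_neg hD0 hh hg htθ
  refine ⟨_, (hu.hasDerivAt_add_diffFlux hp hD0 hV htI hu').fun_neg, neg_nonpos.2 ?_⟩
  have hratio : 1 ≤ (-diffFlux p D u t / V (u t)) ^ (conj p - 1) :=
    Real.one_le_rpow ((one_le_div (hV.pos _ htI)).2 (by linarith))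
      (sub_pos.2 (one_lt_conj hp)).le
  exact add_nonneg (mul_nonneg_of_nonpos_of_nonpos (sub_nonpos.2 hcb) hu'.le)
    (mul_nonneg (hg.pos _ htθ).le (sub_nonneg.2 hratio))

theorem speed_eq (hp : 1 < p) (hD0 : ∀ s ∈ Ioo 0 1, 0 < D s) (hh : ContinuousOn h (Icc 0 1))
    (hg : IsIgnition θ g) (hu : IsProfile p D h g b u)
    (hV : IsFrontFlux (conj p) (fun s => c + h s) (reaction p D g) V) : b = c := by
  obtain ⟨α, hα, hbefore⟩ := hu.exists_first_passage hg.mem_Ioo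
  have hθ : θ ∈ Icc 0 1 := Ioo_subset_Icc_self hg.mem_Ioo
  have hflux := hu.totalFlux_eq_zero_of_first_passage hD0 hh hg hα le_rfl
  have hVθ := hV.eq_convFlux (continuousOn_const.fun_add hh) (hg.reaction hD0) θ
    (right_mem_Icc.2 hθ.1)
  rw [totalFlux, hα, convFlux_const_add b hh hθ] at hflux
  rw [convFlux_const_add c hh hθ] at hVθ
  have hgap : V (u α) + diffFlux p D u α = (c - b) * θ := by rw [hα]; linarith
  rcases le_total b c with hbc | hcb
  · have := hu.add_diffFlux_nonpos hp hD0 hh hg hV hbc hbefore le_rfl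
    rw [hgap] at this
    exact hbc.antisymm (sub_nonpos.1 (nonpos_of_mul_nonpos_left this hg.mem_Ioo.1))
  · have := hu.add_diffFlux_nonneg hp hD0 hh hg hV hcb hbefore le_rfl
    rw [hgap] at this
    exact (sub_nonneg.1 (nonneg_of_mul_nonneg_left this hg.mem_Ioo.1)).antisymm hcb

theorem diffFlux_eq_neg (hp : 1 < p) (hD0 : ∀ s ∈ Ioo 0 1, 0 < D s)
    (hh : ContinuousOn h (Icc 0 1)) (hg : IsIgnition θ g) (hu : IsProfile p D h g c u)
    (hV : IsFrontFlux (conj p) (fun s => c + h s) (reaction p D g) V) (ξ : ℝ) :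
    diffFlux p D u ξ = -V (u ξ) := by
  obtain ⟨α, hα, hbefore⟩ := hu.exists_first_passage hg.mem_Ioo
  rcases le_total ξ α with hξα | hαξ
  · exact eq_neg_of_add_eq_zero_right
      ((hu.add_diffFlux_nonpos hp hD0 hh hg hV le_rfl hbefore hξα).antisymm
        (hu.add_diffFlux_nonneg hp hD0 hh hg hV le_rfl hbefore hξα))
  · rw [hV.eq_convFlux (continuousOn_const.fun_add hh) (hg.reaction hD0) _
      ⟨(hu.mem_Icc ξ).1, hu.le_of_first_passage hD0 hh hg hα hαξ⟩]
    exact eq_neg_of_add_eq_zero_left (hu.totalFlux_eq_zero_of_first_passage hD0 hh hg hα hαξ)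

theorem deriv_eq_neg_decayRate (hp : 1 < p) (hD0 : ∀ s ∈ Ioo 0 1, 0 < D s)
    (hh : ContinuousOn h (Icc 0 1)) (hg : IsIgnition θ g) (hu : IsProfile p D h g c u)
    (hV : IsFrontFlux (conj p) (fun s => c + h s) (reaction p D g) V) (hξ : ξ ∈ interiorSet u) :
    deriv u ξ = -decayRate p D V (u ξ) := by
  have hflux := hu.diffFlux_eq_neg hp hD0 hh hg hV ξ
  have hu' : deriv u ξ < 0 :=
    (diffFlux_neg_iff (hD0 _ hξ) hξ).1 (hflux ▸ neg_lt_zero.2 (hV.pos _ hξ))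
  have hrate := neg_powerLaw_div_rpow hp (hD0 _ hξ) hu'
  rw [← diffFlux_of_mem hξ, hflux, neg_neg] at hrate
  rw [decayRate, hrate, neg_neg]

theorem antitone (hp : 1 < p) (hD0 : ∀ s ∈ Ioo 0 1, 0 < D s)
    (hh : ContinuousOn h (Icc 0 1)) (hg : IsIgnition θ g) (hu : IsProfile p D h g c u)
    (hV : IsFrontFlux (conj p) (fun s => c + h s) (reaction p D g) V) : Antitone u :=
  fun ξ η hξη => le_of_deriv_nonpos_above_of_finite (toFinite {0, 1}) hξη
    hu.continuous.continuousOn le_rfl fun x _ _ hx => by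
      have hxI : x ∈ interiorSet u := not_not.1 fun h =>
        hx (eq_zero_or_eq_one_of_notMem_interiorSet (hu.mem_Icc x) h)
      refine ⟨_, hu.hasDerivAt hxI, ?_⟩
      rw [hu.deriv_eq_neg_decayRate hp hD0 hh hg hV hxI]
      exact neg_nonpos.2 (decayRate_pos hD0 hV hxI).le

theorem exists_arrivalTime_eq_add (hp : 1 < p) (hD : ContinuousOn D (Ioo 0 1))
    (hD0 : ∀ s ∈ Ioo 0 1, 0 < D s) (hh : ContinuousOn h (Icc 0 1)) (hg : IsIgnition θ g)
    (hu : IsProfile p D h g c u)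
    (hV : IsFrontFlux (conj p) (fun s => c + h s) (reaction p D g) V) :
    ∃ τ, ∀ ξ ∈ interiorSet u, arrivalTime p D V (u ξ) = ξ + τ := by
  have hconn : OrdConnected (interiorSet u) :=
    (ordConnected_Ioo (a := (0 : ℝ)) (b := 1)).preimage_anti (hu.antitone hp hD0 hh hg hV)
  have hderiv : ∀ ξ ∈ interiorSet u,
      HasDerivAt (fun ξ => arrivalTime p D V (u ξ) - ξ) 0 ξ := fun ξ hξ => by
    refine (((hasDerivAt_arrivalTime hD hD0 hV hξ).comp ξ (hu.hasDerivAt hξ)).fun_sub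
      (hasDerivAt_id' ξ)).congr_deriv ?_
    rw [hu.deriv_eq_neg_decayRate hp hD0 hh hg hV hξ, neg_mul_neg,
      inv_mul_cancel₀ (decayRate_pos hD0 hV hξ).ne', sub_self]
  obtain ⟨τ, hτ⟩ := (isOpen_interiorSet hu.continuous).exists_is_const_of_deriv_eq_zero
    hconn.isPreconnected (fun ξ hξ => (hderiv ξ hξ).differentiableAt.differentiableWithinAt)
    fun ξ hξ => (hderiv ξ hξ).deriv
  exact ⟨τ, fun ξ hξ => sub_eq_iff_eq_add'.1 (hτ ξ hξ)⟩

theorem exists_eq_profileOf_add (hp : 1 < p) (hD : ContinuousOn D (Ioo 0 1))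
    (hD0 : ∀ s ∈ Ioo 0 1, 0 < D s) (hh : ContinuousOn h (Icc 0 1)) (hg : IsIgnition θ g)
    (hu : IsProfile p D h g c u)
    (hV : IsFrontFlux (conj p) (fun s => c + h s) (reaction p D g) V) :
    ∃ τ, ∀ ξ, u ξ = profileOf (arrivalTime p D V) (ξ + τ) := by
  obtain ⟨τ, hτ⟩ := hu.exists_arrivalTime_eq_add hp hD hD0 hh hg hV
  refine ⟨τ, fun ξ => eq_of_forall_mem_Ioo_lt_iff (hu.mem_Icc ξ) (profileOf_mem_Icc _ _)
    fun s hs => ?_⟩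
  obtain ⟨η, rfl, hbefore⟩ := hu.exists_first_passage hs
  rw [lt_profileOf_iff (strictAntiOn_arrivalTime hD hD0 hV) (continuousOn_arrivalTime hD hD0 hV) hs,
    hτ η hs, add_lt_add_iff_right]
  exact ⟨(hu.antitone hp hD0 hh hg hV).reflect_lt, hbefore ξ⟩

end IsProfile

theorem IsFrontFlux.isUniqueWaveSpeed {p θ c : ℝ} {D h g V : ℝ → ℝ} (hp : 1 < p)
    (hD : ContinuousOn D (Ioo 0 1)) (hD0 : ∀ s ∈ Ioo 0 1, 0 < D s)
    (hh : ContinuousOn h (Icc 0 1)) (hg : IsIgnition θ g)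
    (hV : IsFrontFlux (conj p) (fun s => c + h s) (reaction p D g) V) :
    IsUniqueWaveSpeed p D h g c where
  exists_profile := ⟨_, hV.isProfile_profileOf hp hD hD0⟩
  profile_unique := fun u v hu hv => by
    obtain ⟨τ, hτ⟩ := hu.exists_eq_profileOf_add hp hD hD0 hh hg hV
    obtain ⟨σ, hσ⟩ := hv.exists_eq_profileOf_add hp hD hD0 hh hg hV
    exact ⟨σ - τ, fun ξ => by rw [hσ, hτ, add_assoc, sub_add_cancel]⟩
  speed_unique := fun _ _ hu => hu.speed_eq hp hD0 hh hg hV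

theorem hMin_pos {h : ℝ → ℝ} (hh : ContinuousOn h (Icc 0 1)) (hh0 : ∀ u ∈ Icc 0 1, 0 < h u) :
    0 < hMin h := by
  obtain ⟨u, hu, hmin⟩ := isCompact_Icc.exists_isMinOn (nonempty_Icc.2 zero_le_one) hh
  exact (hh0 u hu).trans_le (le_csInf ((nonempty_Icc.2 zero_le_one).image h)
    (forall_mem_image.2 hmin))

theorem rpow_kConst_mul_lt {p I : ℝ} (hp : 1 < p) (hI : 0 < I) :
    (kConst p * I) ^ (1 / conj p) < (conj p * I) ^ (1 / conj p) := by
  have hk := kConst_mem_Ioc hp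
  have hq := one_lt_conj hp
  exact Real.rpow_lt_rpow (mul_pos hk.1 hI).le (mul_lt_mul_of_pos_right (hk.2.trans_lt hq) hI)
    (one_div_pos.2 (zero_lt_one.trans hq))

end TravelingWave

open TravelingWave in
theorem theorem3_general (p θ m : ℝ) (D h g : ℝ → ℝ) (hp : 1 < p) (hθ : θ ∈ Ioo 0 1)
    (hD : ContinuousOn D (Ioo 0 1)) (hDpos : ∀ u ∈ Ioo 0 1, 0 < D u)
    (hh : ContinuousOn h (Icc 0 1)) (hm : ∀ u ∈ Icc 0 1, m ≤ h u)
    (hg : ContinuousOn g (Ioo 0 1)) (hg_zero : ∀ u ∈ Ioc 0 θ, g u = 0)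
    (hg_pos : ∀ u ∈ Ioo θ 1, 0 < g u)
    (hint : IntervalIntegrable (fun u => D u ^ (conj p - 1) * g u) MeasureTheory.volume 0 1)
    (hH : convFlux h 1 - m <
      (conj p * ∫ u in (0 : ℝ)..1, D u ^ (conj p - 1) * g u) ^ (1 / conj p)) :
    ∃ c, IsUniqueWaveSpeed p D h g c ∧ -m < c := by
  have hg' : IsIgnition θ g := ⟨hθ, hg_zero, hg_pos⟩
  have hr : IsIgnition θ (reaction p D g) := hg'.reaction hDpos
  have hq := one_lt_conj hp
  have hI := mul_pos (zero_lt_one.trans hq) (hr.integral_pos hint)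
  have hk : ContinuousOn (fun s => -m + h s) (Icc 0 1) := continuousOn_const.fun_add hh
  have hk0 : ∀ s ∈ Icc 0 1, 0 ≤ -m + h s := fun s hs => by linarith [hm s hs]
  have hone : (1 : ℝ) ∈ Icc 0 1 := right_mem_Icc.2 zero_le_one
  have hH' : convFlux (fun s => -m + h s) 1 ^ conj p <
      conj p * ∫ u in (0 : ℝ)..1, reaction p D g u := by
    rw [← Real.lt_rpow_inv_iff_of_pos (convFlux_nonneg hk0 hone) hI.le (zero_lt_one.trans hq),
      convFlux_const_add _ hh hone, mul_one, neg_add_eq_sub, ← one_div]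
    exact hH
  obtain ⟨c, V, hc, hV⟩ :=
    exists_frontFlux hq hk hk0 hr (continuousOn_reaction hD hDpos hg) hint hH'
  simp only [← add_assoc, ← sub_eq_add_neg] at hV
  exact ⟨c - m, hV.isUniqueWaveSpeed hp hD hDpos hh hg', by linarith⟩

theorem theorem3 (p θ : ℝ) (D h g : ℝ → ℝ)
    (hp : 1 < p) (hθ : θ ∈ Set.Ioo (0 : ℝ) 1)
    (hD : ContDiffOn ℝ 1 D (Set.Ioo 0 1)) (hDpos : ∀ u ∈ Set.Ioo (0 : ℝ) 1, 0 < D u)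
    (hh : ContinuousOn h (Set.Icc 0 1))
    (hg : ContinuousOn g (Set.Icc 0 1))
    (hg_zero : ∀ u ∈ Set.Icc 0 θ, g u = 0) (hg_pos : ∀ u ∈ Set.Ioo θ 1, 0 < g u)
    (hg_one : g 1 = 0)
    (hint : IntervalIntegrable (fun u => D u ^ (TravelingWave.conj p - 1) * g u)
      MeasureTheory.volume 0 1)
    (hh_pos : ∀ u ∈ Set.Icc (0 : ℝ) 1, 0 < h u)
    (hH : TravelingWave.convFlux h 1 ≤
      (TravelingWave.kConst p *
        ∫ u in (0 : ℝ)..1, D u ^ (TravelingWave.conj p - 1) * g u)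
          ^ (1 / TravelingWave.conj p)) :
    ∃ c : ℝ, TravelingWave.IsUniqueWaveSpeed p D h g c ∧
      0 < c ∧ -TravelingWave.hMin h < 0 := by
  have hg' : TravelingWave.IsIgnition θ g :=
    ⟨hθ, fun u hu => hg_zero u (Ioc_subset_Icc_self hu), hg_pos⟩
  have hI := (hg'.reaction hDpos (p := p)).integral_pos hint
  obtain ⟨c, hc, hc0⟩ := theorem3_general p θ 0 D h g hp hθ hD.continuousOn hDpos hh
    (fun u hu => (hh_pos u hu).le) (hg.mono Ioo_subset_Icc_self) hg'.eq_zero hg_pos hint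
    ((sub_zero (TravelingWave.convFlux h 1)).trans_lt
      (hH.trans_lt (TravelingWave.rpow_kConst_mul_lt hp hI)))
  exact ⟨c, hc, neg_zero (G := ℝ) ▸ hc0, neg_lt_zero.2 (TravelingWave.hMin_pos hh hh_pos)⟩
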